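/- There is a universal constant $C_2\ge 8$ such that the following holds, where for $\alpha\in(0,1]$ we put $C_\alpha := (C_2/\alpha)^{\ln 2/\alpha}$. Let $n\ge 1$ and $C\geq 2$ be integers and let $M\in\mathbb{R}^{n\times Cn}$ be a random matrix such that all entries $M_{i,j}$ in the staircase $j>(i-1)C$ are together i.i.d. standard Gaussians $\mathcal{N}(0,1)$. Suppose further that for every $i\in\{1,\dots,n\}$ the family of staircase entries $M_{u,v}$ with $v>(u-1)C$ and $v>C(i-1)$ is independent of the sub-matrix $(M_{u,v})_{1\le u\le i,\ 1\le v\le C(i-1)}$. Then for every $\alpha\in(0,1]$, if $C\geq C_\alpha\ln n$, we have $$\mathbb{P}\left(\sigma_1(M) < \frac{1}{6}\sqrt{\frac{C}{n^{\alpha}}}\right)\leq 3e^{-C/16},$$ where $\sigma_1(M)\le\dots\le\sigma_n(M)$ denote the $n$ singular values of $M$, so that $\sigma_1(M)$ is the smallest one. -/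

import Mathlib

open MeasureTheory ProbabilityTheory

/-- The smallest singular value `σ₁(M)` of a real `n × m` matrix `M` with `n ≤ m`, which has `n`
singular values `σ₁ ≤ ⋯ ≤ σₙ` (those of the transpose, seen as a map from `ℝⁿ` to `ℝᵐ` with Euclidean
norms).  Mathlib lists the singular values in decreasing order from index `0`, so the smallest of the
`n` singular values has index `n - 1`. -/
noncomputable def minSingularValue {n m : ℕ} (M : Matrix (Fin n) (Fin m) ℝ) : ℝ :=
  (Matrix.toEuclideanLin M.transpose).singularValues (n - 1)

/-- The staircase `j > (i - 1) C` of an `n × Cn` matrix (with `1`-based indices `i`, `j`).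
For the `0`-based indices of `Fin` this reads `i C ≤ j`. -/
def InStaircase {n C : ℕ} (i : Fin n) (j : Fin (C * n)) : Prop :=
  (i : ℕ) * C ≤ (j : ℕ)

/-- All entries of the random matrix `M` in the staircase are together i.i.d. `𝒩(0, 1)`. -/
def StaircaseIIDGaussian {Ω : Type*} [MeasurableSpace Ω] (P : Measure Ω) {n C : ℕ}
    (M : Ω → Matrix (Fin n) (Fin (C * n)) ℝ) : Prop :=
  (∀ (i : Fin n) (j : Fin (C * n)), InStaircase i j →
      HasLaw (fun ω => M ω i j) (gaussianReal 0 1) P) ∧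
    iIndepFun
      (fun (p : {p : Fin n × Fin (C * n) // InStaircase p.1 p.2}) ω => M ω p.1.1 p.1.2) P

/-- For every `i ∈ {1, …, n}`, the staircase entries `M u v` with `v > C (i - 1)` are together
independent from the sub-matrix of the entries `M u v` with `u ≤ i` and `v ≤ C (i - 1)`
(`1`-based indices; the code has `0`-based ones). -/
def StaircaseAdaptive {Ω : Type*} [MeasurableSpace Ω] (P : Measure Ω) {n C : ℕ}
    (M : Ω → Matrix (Fin n) (Fin (C * n)) ℝ) : Prop :=
  ∀ i : Fin n,
    IndepFun
      (fun ω (p : {p : Fin n × Fin (C * n) // InStaircase p.1 p.2 ∧ C * (i : ℕ) ≤ (p.2 : ℕ)}) =>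
        M ω p.1.1 p.1.2)
      (fun ω (p : {p : Fin n × Fin (C * n) // p.1 ≤ i ∧ (p.2 : ℕ) < C * (i : ℕ)}) =>
        M ω p.1.1 p.1.2) P

/-- The constant `C_α = (C₂ / α) ^ (ln 2 / α)`. -/
noncomputable def staircaseConst (C₂ α : ℝ) : ℝ := (C₂ / α) ^ (Real.log 2 / α)

/-! The proof gives `σ₁ ≥ √C / 6` outside an event of probability `exp (-C / 16)`, without the
factor `n ^ (-α)`; for `n ≥ 2` it only uses that `C` is at least `10 ^ 7 * log n`.

Call the rows up to `i` and the columns before block `i` the old block of `i`. Its smallest singular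
value may vanish, so a weaker property is propagated: its `j`-th smallest squared singular value,
counted from `j = 0`, is at least `C j / 36` (`SpectrumSpread`). Add `k` fresh column blocks, a
Gaussian matrix `G` independent of the old block. By `gaussianMatrix_real_lt_of_spectrumSpread`,
with high probability all squared singular values rise to `C k / 36`. On the span of about the first
`C k / 100` singular directions `G` alone achieves this, by a net argument. On the other directions
the old block has squared singular values of order at least `C² k`, and `G` cannot cancel it: with
direction `j` damped by the inverse singular value, the variances have a harmonic sum, at most `36
(1 + log n) / C`, so `G` is small relative to the old block.

`spectrumSpread_oldBlock` closes the induction: a subspace of dimension `r + 1` contains a nonzero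
vector supported on the rows up to `i - r`, and on it the old block of `i` acts as the old block of
`i - r` with `r` fresh blocks added. A union bound over all pairs `(i, k)` concludes. -/

/-! ### Nets on unit spheres. -/

/-- A finite separated family in the unit ball has at most `(1 + 2 / ε) ^ dim` elements. -/
theorem card_le_of_separated_unit_ball {E : Type*} [NormedAddCommGroup E] [NormedSpace ℝ E]
    [FiniteDimensional ℝ E] {ε : ℝ} (hε : 0 < ε) (s : Finset E) (hs : ∀ c ∈ s, ‖c‖ ≤ 1)
    (h : ∀ c ∈ s, ∀ d ∈ s, c ≠ d → ε ≤ ‖c - d‖) :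
    (s.card : ℝ) ≤ (1 + 2 / ε) ^ Module.finrank ℝ E := by
  borelize E
  let μ : Measure E := Measure.addHaar
  have hδ : 0 < ε / 2 := by positivity
  have hρ : 0 < 1 + ε / 2 := by positivity
  have D : Set.Pairwise (s : Set E) (Function.onFun Disjoint fun c => Metric.ball c (ε / 2)) := by
    rintro c hc d hd hcd
    apply Metric.ball_disjoint_ball
    rw [dist_eq_norm]
    linarith [h c hc d hd hcd]
  have hsub : (⋃ c ∈ s, Metric.ball c (ε / 2)) ⊆ Metric.ball (0 : E) (1 + ε / 2) := by
    refine Set.iUnion₂_subset fun x hx => Metric.ball_subset_ball' ?_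
    rw [dist_zero_right]
    linarith [hs x hx]
  have I : (s.card : ENNReal) * ENNReal.ofReal ((ε / 2) ^ Module.finrank ℝ E) *
      μ (Metric.ball 0 1) ≤
      ENNReal.ofReal ((1 + ε / 2) ^ Module.finrank ℝ E) * μ (Metric.ball 0 1) := by
    calc _ = μ (⋃ c ∈ s, Metric.ball c (ε / 2)) := by
          rw [measure_biUnion_finset D fun c _ => measurableSet_ball]
          simp only [μ.addHaar_ball_of_pos _ hδ, Finset.sum_const, nsmul_eq_mul, mul_assoc]
      _ ≤ μ (Metric.ball (0 : E) (1 + ε / 2)) := measure_mono hsub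
      _ = _ := by simp only [μ.addHaar_ball_of_pos _ hρ]
  have J := (ENNReal.mul_le_mul_iff_left (Metric.measure_ball_pos _ _ zero_lt_one).ne'
    measure_ball_lt_top.ne).1 I
  have K := ENNReal.toReal_le_of_le_ofReal (pow_nonneg hρ.le _) J
  rw [ENNReal.toReal_mul, ENNReal.toReal_natCast, ENNReal.toReal_ofReal (by positivity)] at K
  have : (1 + 2 / ε) = (1 + ε / 2) / (ε / 2) := by field_simp; ring
  rw [this, div_pow, le_div_iff₀ (by positivity)]
  exact K

/-- The unit sphere of a finite-dimensional space has a finite `ε`-net of size at most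
`(1 + 2 / ε) ^ dim`. -/
theorem exists_sphere_net (E : Type*) [NormedAddCommGroup E] [NormedSpace ℝ E]
    [FiniteDimensional ℝ E] {ε : ℝ} (hε : 0 < ε) :
    ∃ s : Finset E, (∀ x ∈ s, ‖x‖ = 1) ∧ (∀ x : E, ‖x‖ = 1 → ∃ y ∈ s, ‖x - y‖ ≤ ε) ∧
      (s.card : ℝ) ≤ (1 + 2 / ε) ^ Module.finrank ℝ E := by
  classical
  let p : Finset E → Prop := fun s =>
    (∀ x ∈ s, ‖x‖ = 1) ∧ ∀ c ∈ s, ∀ d ∈ s, c ≠ d → ε ≤ ‖c - d‖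
  have hcard : ∀ s, p s → (s.card : ℝ) ≤ (1 + 2 / ε) ^ Module.finrank ℝ E := fun s hs =>
    card_le_of_separated_unit_ball hε s (fun c hc => (hs.1 c hc).le) hs.2
  let T : Set ℕ := {k | ∃ s, p s ∧ s.card = k}
  have hT : T.Nonempty := ⟨0, ∅, by simp [p], rfl⟩
  have hb : BddAbove T := by
    refine ⟨⌊(1 + 2 / ε) ^ Module.finrank ℝ E⌋₊, ?_⟩
    rintro k ⟨s, hs, rfl⟩
    exact Nat.le_floor (hcard s hs)
  -- A separated family of maximal size is a net: a point farther than `ε` from all its members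
  -- could be added.
  obtain ⟨s, hs, hmax⟩ := Nat.sSup_mem hT hb
  refine ⟨s, hs.1, fun x hx => ?_, hcard s hs⟩
  by_contra! hcon
  have hxs : x ∉ s := fun h => by simpa using (hcon x h).trans' hε
  have hp : p (insert x s) := by
    refine ⟨?_, ?_⟩
    · intro y hy
      rcases Finset.mem_insert.1 hy with rfl | hy
      exacts [hx, hs.1 y hy]
    · intro c hc d hd hcd
      rcases Finset.mem_insert.1 hc with hc | hc <;> rcases Finset.mem_insert.1 hd with hd | hd
      · exact absurd (hc.trans hd.symm) hcd
      · rw [hc]; exact (hcon d hd).le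
      · rw [hd, norm_sub_rev]; exact (hcon c hc).le
      · exact hs.2 c hc d hd hcd
  have := le_csSup hb (show (insert x s).card ∈ T from ⟨_, hp, rfl⟩)
  rw [Finset.card_insert_of_notMem hxs, ← hmax] at this
  omega

/-- A linear map bounded on a net of the unit sphere is bounded. -/
theorem norm_le_of_net {E F : Type*} [NormedAddCommGroup E] [NormedSpace ℝ E]
    [NormedAddCommGroup F] [NormedSpace ℝ F] {ε B : ℝ} (hε1 : ε < 1) (hB : 0 ≤ B)
    (T : E →L[ℝ] F) (s : Finset E) (hnet : ∀ x : E, ‖x‖ = 1 → ∃ y ∈ s, ‖x - y‖ ≤ ε)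
    (hs : ∀ y ∈ s, ‖T y‖ ≤ B) (x : E) : ‖T x‖ ≤ B / (1 - ε) * ‖x‖ := by
  -- In the trivial space the net condition is void and does not force `0 ≤ ε`.
  by_cases hE : ∃ x : E, ‖x‖ = 1
  · have hε0 : 0 ≤ ε := by
      obtain ⟨x, hx⟩ := hE
      obtain ⟨y, -, hy⟩ := hnet x hx
      exact (norm_nonneg _).trans hy
    have h1 : ‖T‖ ≤ B + ‖T‖ * ε := by
      refine ContinuousLinearMap.opNorm_le_of_unit_norm (by positivity) fun x hx => ?_
      obtain ⟨y, hys, hy⟩ := hnet x hx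
      calc ‖T x‖ = ‖T y + T (x - y)‖ := by rw [← map_add]; congr 2; abel
        _ ≤ ‖T y‖ + ‖T (x - y)‖ := norm_add_le _ _
        _ ≤ B + ‖T‖ * ε := add_le_add (hs y hys)
            ((T.le_opNorm _).trans (mul_le_mul_of_nonneg_left hy (norm_nonneg _)))
    have h2 : ‖T‖ ≤ B / (1 - ε) := by
      rw [le_div_iff₀ (by linarith)]; linarith
    exact (T.le_opNorm x).trans (mul_le_mul_of_nonneg_right h2 (norm_nonneg _))
  · have hx : x = 0 := by
      by_contra hx
      exact hE ⟨(‖x‖⁻¹ : ℝ) • x, by rw [norm_smul, norm_inv, norm_norm]; field_simp⟩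
    simp [hx]

/-- A linear map bounded above and below on a net of the unit sphere is bounded below. -/
theorem le_norm_of_net {E F : Type*} [NormedAddCommGroup E] [NormedSpace ℝ E]
    [NormedAddCommGroup F] [NormedSpace ℝ F] {ε a B : ℝ} (hε1 : ε < 1) (hB : 0 ≤ B)
    (T : E →L[ℝ] F) (s : Finset E) (hnet : ∀ x : E, ‖x‖ = 1 → ∃ y ∈ s, ‖x - y‖ ≤ ε)
    (hs : ∀ y ∈ s, ‖T y‖ ≤ B) (hs' : ∀ y ∈ s, a ≤ ‖T y‖) (x : E) :
    (a - B / (1 - ε) * ε) * ‖x‖ ≤ ‖T x‖ := by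
  by_cases hx : x = 0
  · simp [hx]
  have hx' : 0 < ‖x‖ := norm_pos_iff.2 hx
  have key : ∀ u : E, ‖u‖ = 1 → a - B / (1 - ε) * ε ≤ ‖T u‖ := by
    intro u hu
    obtain ⟨y, hys, hy⟩ := hnet u hu
    have h1 := norm_le_of_net hε1 hB T s hnet hs (y - u)
    have h2 : B / (1 - ε) * ‖y - u‖ ≤ B / (1 - ε) * ε := by
      rw [norm_sub_rev]
      exact mul_le_mul_of_nonneg_left hy (div_nonneg hB (by linarith))
    have h3 : ‖T y‖ ≤ ‖T u‖ + ‖T (y - u)‖ := by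
      rw [map_sub]; simpa using norm_add_le (T u) (T y - T u)
    linarith [hs' y hys]
  have := key ((‖x‖⁻¹ : ℝ) • x) (by rw [norm_smul, norm_inv, norm_norm]; field_simp)
  rw [map_smul, norm_smul, norm_inv, norm_norm, inv_mul_eq_div, le_div_iff₀ hx'] at this
  exact this

/-! ### Tails of quadratic forms in Gaussian vectors. -/

theorem integral_exp_sq_gaussianReal {a : ℝ} (ha : a < 1 / 2) :
    ∫ x, Real.exp (a * x ^ 2) ∂(gaussianReal 0 1) = (√(1 - 2 * a))⁻¹ := by
  rw [integral_gaussianReal_eq_integral_smul one_ne_zero]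
  have h : ∀ x : ℝ, gaussianPDFReal 0 1 x • Real.exp (a * x ^ 2) =
      (√(2 * Real.pi))⁻¹ * Real.exp (-(1 / 2 - a) * x ^ 2) := by
    intro x
    rw [gaussianPDFReal, smul_eq_mul, mul_assoc, ← Real.exp_add]
    simp only [NNReal.coe_one, mul_one, sub_zero]
    congr 2
    ring
  simp_rw [h]
  rw [integral_const_mul, integral_gaussian, ← Real.sqrt_inv, ← Real.sqrt_inv,
    ← Real.sqrt_mul (by positivity)]
  congr 1
  have : (1 / 2 - a) ≠ 0 := by linarith
  have : (1 - a * 2) ≠ 0 := by linarith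
  have := Real.pi_ne_zero
  field_simp

theorem integral_exp_quadratic_stdGaussian {ι E : Type*} [Fintype ι] [NormedAddCommGroup E]
    [InnerProductSpace ℝ E] [FiniteDimensional ℝ E] [MeasurableSpace E] [BorelSpace E]
    (b : OrthonormalBasis ι ℝ E) {a : ι → ℝ} (ha : ∀ i, a i < 1 / 2) :
    ∫ x, Real.exp (∑ i, a i * inner ℝ (b i) x ^ 2) ∂(stdGaussian E) =
      ∏ i, (√(1 - 2 * a i))⁻¹ := by
  classical
  rw [stdGaussian_eq_map_pi_orthonormalBasis b,
    integral_map (Measurable.aemeasurable (by fun_prop)) (by fun_prop)]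
  have h : ∀ (x : ι → ℝ) i, inner ℝ (b i) (∑ j, x j • b j) = x i := fun x i => by
    simp [inner_sum, inner_smul_right, b.inner_eq_ite]
  simp_rw [h, Real.exp_sum]
  rw [integral_fintype_prod_eq_prod (f := fun i x => Real.exp (a i * x ^ 2))]
  exact Finset.prod_congr rfl fun i _ => integral_exp_sq_gaussianReal (ha i)

/-- Chernoff's bound; parameter 1 suffices because the weights `a` absorb the scaling. -/
theorem stdGaussian_real_quadratic_ge_le {ι E : Type*} [Fintype ι] [NormedAddCommGroup E]
    [InnerProductSpace ℝ E] [FiniteDimensional ℝ E] [MeasurableSpace E] [BorelSpace E]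
    (b : OrthonormalBasis ι ℝ E) {a : ι → ℝ} (ha : ∀ i, a i < 1 / 2) (η : ℝ) :
    (stdGaussian E).real {x | η ≤ ∑ i, a i * inner ℝ (b i) x ^ 2} ≤
      Real.exp (-η) * ∏ i, (√(1 - 2 * a i))⁻¹ := by
  have hI := integral_exp_quadratic_stdGaussian b ha
  have hpos : 0 < ∏ i, (√(1 - 2 * a i))⁻¹ := Finset.prod_pos fun i _ =>
    inv_pos.2 (Real.sqrt_pos.2 (by linarith [ha i]))
  have hint : Integrable (fun x => Real.exp (∑ i, a i * inner ℝ (b i) x ^ 2)) (stdGaussian E) := by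
    -- The integral of a non-integrable function is 0 by convention, so a positive value proves
    -- integrability.
    by_contra h
    rw [integral_undef h] at hI
    exact hpos.ne hI
  have := measure_ge_le_exp_mul_mgf (μ := stdGaussian E)
    (X := fun x => ∑ i, a i * inner ℝ (b i) x ^ 2) (t := 1) η zero_le_one (by simpa using hint)
  simpa [mgf, hI] using this

theorem stdGaussian_real_norm_sq_le_le (E : Type*) [NormedAddCommGroup E]
    [InnerProductSpace ℝ E] [FiniteDimensional ℝ E] [MeasurableSpace E] [BorelSpace E] :
    (stdGaussian E).real {x | ‖x‖ ^ 2 ≤ Module.finrank ℝ E / 4} ≤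
      Real.exp (-(3 / 10) * Module.finrank ℝ E) := by
  set b := stdOrthonormalBasis ℝ E
  -- The weight makes `√(1 - 2 a) = 2`; the rate is `3 / 8 - log 2 < -3 / 10`.
  have h := stdGaussian_real_quadratic_ge_le b (a := fun _ => -(3 / 2)) (fun _ => by norm_num)
    (-(3 / 8) * Module.finrank ℝ E)
  simp_rw [← Finset.mul_sum, b.sum_sq_inner_right] at h
  have h2 : (√(1 - 2 * -(3 / 2)))⁻¹ = Real.exp (-Real.log 2) := by
    rw [show (1 - 2 * -(3 / 2) : ℝ) = 2 ^ 2 by norm_num, Real.sqrt_sq (by norm_num), Real.exp_neg,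
      Real.exp_log (by norm_num)]
  rw [h2, Finset.prod_const, Finset.card_univ, Fintype.card_fin, ← Real.exp_nat_mul,
    ← Real.exp_add] at h
  refine le_trans (measureReal_mono ?_) (h.trans (Real.exp_le_exp.2 ?_))
  · intro x hx
    simp only [Set.mem_ofPred_eq] at hx ⊢
    linarith
  · have := Real.log_two_gt_d9
    have hn : (0 : ℝ) ≤ Module.finrank ℝ E := by positivity
    nlinarith

theorem stdGaussian_real_le_norm_sq_le (E : Type*) [NormedAddCommGroup E]
    [InnerProductSpace ℝ E] [FiniteDimensional ℝ E] [MeasurableSpace E] [BorelSpace E] :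
    (stdGaussian E).real {x | 4 * (Module.finrank ℝ E : ℝ) ≤ ‖x‖ ^ 2} ≤
      Real.exp (-(3 / 10) * Module.finrank ℝ E) := by
  set b := stdOrthonormalBasis ℝ E
  have h := stdGaussian_real_quadratic_ge_le b (a := fun _ => 3 / 8) (fun _ => by norm_num)
    (3 / 2 * Module.finrank ℝ E)
  simp_rw [← Finset.mul_sum, b.sum_sq_inner_right] at h
  have h2 : (√(1 - 2 * (3 / 8)))⁻¹ = Real.exp (Real.log 2) := by
    rw [show (1 - 2 * (3 / 8) : ℝ) = (1 / 2) ^ 2 by norm_num, Real.sqrt_sq (by norm_num),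
      Real.exp_log (by norm_num)]
    norm_num
  rw [h2, Finset.prod_const, Finset.card_univ, Fintype.card_fin, ← Real.exp_nat_mul,
    ← Real.exp_add] at h
  refine le_trans (measureReal_mono ?_) (h.trans (Real.exp_le_exp.2 ?_))
  · intro x hx
    simp only [Set.mem_ofPred_eq] at hx ⊢
    linarith
  · have := Real.log_two_lt_d9
    have hn : (0 : ℝ) ≤ Module.finrank ℝ E := by positivity
    nlinarith

/-- Upper tail of a weighted sum of squares of the coordinates of a Gaussian vector, with
small weights. -/
theorem stdGaussian_real_weighted_ge_le {ι E : Type*} [Fintype ι] [NormedAddCommGroup E]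
    [InnerProductSpace ℝ E] [FiniteDimensional ℝ E] [MeasurableSpace E] [BorelSpace E]
    (b : OrthonormalBasis ι ℝ E) {w : ι → ℝ} {Λ η : ℝ} (hΛ : 0 < Λ)
    (hw1 : ∀ i, Λ * w i ≤ 1) (hw0 : ∀ i, 0 ≤ w i) (hsum : ∑ i, w i ≤ η / 4) :
    (stdGaussian E).real {x | η ≤ ∑ i, w i * inner ℝ (b i) x ^ 2} ≤
      Real.exp (-(Λ * η / 8)) := by
  have h := stdGaussian_real_quadratic_ge_le b (a := fun i => Λ / 4 * w i)
    (fun i => by linarith [hw1 i]) (Λ / 4 * η)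
  have h2 : ∏ i, (√(1 - 2 * (Λ / 4 * w i)))⁻¹ ≤ ∏ i, Real.exp (Λ / 2 * w i) := by
    refine Finset.prod_le_prod (fun i _ => by positivity) fun i _ => ?_
    have hy0 : 0 ≤ Λ * w i := mul_nonneg hΛ.le (hw0 i)
    -- With `y = Λ w i ∈ [0, 1]`: `exp (-y) ≤ 1 / (1 + y) ≤ 1 - y / 2`.
    have h1 : Real.exp (-(Λ / 2 * w i)) ≤ √(1 - 2 * (Λ / 4 * w i)) := by
      apply Real.le_sqrt_of_sq_le
      rw [← Real.exp_nat_mul]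
      have hy := hw1 i
      have h3 := Real.add_one_le_exp (Λ * w i)
      have h4 : Real.exp (((2 : ℕ) : ℝ) * -(Λ / 2 * w i)) = (Real.exp (Λ * w i))⁻¹ := by
        rw [← Real.exp_neg]; congr 1; push_cast; ring
      rw [h4]
      calc (Real.exp (Λ * w i))⁻¹ ≤ (1 + Λ * w i)⁻¹ :=
            inv_anti₀ (by linarith) (by linarith)
        _ ≤ 1 - 2 * (Λ / 4 * w i) := by
            rw [inv_le_iff_one_le_mul₀ (by linarith)]
            nlinarith
    rw [← neg_neg (Λ / 2 * w i), Real.exp_neg]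
    exact inv_anti₀ (Real.exp_pos _) h1
  rw [← Real.exp_sum, ← Finset.mul_sum] at h2
  refine le_trans (measureReal_mono ?_) (h.trans ?_)
  · intro x hx
    simp only [Set.mem_ofPred_eq] at hx ⊢
    simp_rw [mul_assoc, ← Finset.mul_sum]
    exact mul_le_mul_of_nonneg_left hx (by positivity)
  · calc _ ≤ Real.exp (-(Λ / 4 * η)) * Real.exp (Λ / 2 * ∑ i, w i) :=
          mul_le_mul_of_nonneg_left h2 (Real.exp_pos _).le
      _ ≤ _ := by
          rw [← Real.exp_add, Real.exp_le_exp]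
          nlinarith

/-! ### Gaussian matrices and net bounds for them. -/

/-- A linear map whose adjoint is isometric maps the standard Gaussian measure to the standard
Gaussian measure. -/
theorem map_stdGaussian_of_adjoint_isometry {E F : Type*} [NormedAddCommGroup E]
    [InnerProductSpace ℝ E] [FiniteDimensional ℝ E] [MeasurableSpace E] [BorelSpace E]
    [NormedAddCommGroup F] [InnerProductSpace ℝ F] [FiniteDimensional ℝ F] [MeasurableSpace F]
    [BorelSpace F] (f : E → F) (hf : Measurable f) (f' : F → E)
    (hadj : ∀ g t, inner ℝ (f g) t = inner ℝ g (f' t)) (hnorm : ∀ t, ‖f' t‖ = ‖t‖) :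
    (stdGaussian E).map f = stdGaussian F := by
  have := Measure.isProbabilityMeasure_map (μ := stdGaussian E) hf.aemeasurable
  apply Measure.ext_of_charFun
  ext t
  -- The characteristic function of a standard Gaussian depends only on the norm, which `f'`
  -- preserves.
  rw [charFun_stdGaussian, ← hnorm, ← charFun_stdGaussian, charFun_apply, charFun_apply,
    integral_map hf.aemeasurable (by fun_prop)]
  simp_rw [hadj]

/-- The map `x ↦ wᵀ x` between Euclidean spaces, for a matrix `w` given by its entries. -/
noncomputable def transposeMulCLM {ι κ : Type*} [Fintype ι] [Fintype κ] (w : ι × κ → ℝ) :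
    EuclideanSpace ℝ ι →L[ℝ] EuclideanSpace ℝ κ :=
  LinearMap.toContinuousLinearMap
    { toFun := fun x => WithLp.toLp 2 fun v => ∑ u, w (u, v) * x u
      map_add' := fun x y => by ext v; simp [mul_add, Finset.sum_add_distrib]
      map_smul' := fun r x => by ext v; simp [Finset.mul_sum, mul_left_comm] }

@[simp]
theorem transposeMulCLM_apply {ι κ : Type*} [Fintype ι] [Fintype κ] (w : ι × κ → ℝ)
    (x : EuclideanSpace ℝ ι) (v : κ) : transposeMulCLM w x v = ∑ u, w (u, v) * x u := rfl

theorem norm_sq_transposeMulCLM {ι κ : Type*} [Fintype ι] [Fintype κ] (w : ι × κ → ℝ)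
    (x : EuclideanSpace ℝ ι) : ‖transposeMulCLM w x‖ ^ 2 = ∑ v, (∑ u, w (u, v) * x u) ^ 2 := by
  simp [EuclideanSpace.real_norm_sq_eq]

theorem inner_transposeMulCLM {ι κ : Type*} [Fintype ι] [Fintype κ] (w : ι × κ → ℝ)
    (x : EuclideanSpace ℝ ι) (y : EuclideanSpace ℝ κ) :
    inner ℝ (transposeMulCLM w x) y =
      inner ℝ x (transposeMulCLM (fun p : κ × ι => w p.swap) y) := by
  simp only [PiLp.inner_apply, transposeMulCLM_apply, RCLike.inner_apply, conj_trivial,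
    Finset.sum_mul, Finset.mul_sum, Prod.swap_prod_mk]
  rw [Finset.sum_comm]
  exact Finset.sum_congr rfl fun u _ => Finset.sum_congr rfl fun v _ => by ring

theorem continuous_transposeMulCLM_apply {ι κ : Type*} [Fintype ι] [Fintype κ]
    (x : EuclideanSpace ℝ ι) : Continuous fun w : ι × κ → ℝ => transposeMulCLM w x := by
  refine (PiLp.continuous_toLp 2 _).comp (continuous_pi fun v => ?_)
  fun_prop

/-- The standard Gaussian measure on matrices. -/
noncomputable def gaussianMatrix (ι κ : Type*) [Fintype ι] [Fintype κ] : Measure (ι × κ → ℝ) :=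
  Measure.pi fun _ => gaussianReal 0 1

instance {ι κ : Type*} [Fintype ι] [Fintype κ] : IsProbabilityMeasure (gaussianMatrix ι κ) := by
  unfold gaussianMatrix; infer_instance

/-- The adjoint of `w ↦ wᵀ x` is `t ↦ x ⊗ t`, an isometry since `‖x ⊗ t‖ = ‖x‖ ‖t‖`. -/
theorem map_gaussianMatrix_transposeMulCLM {ι κ : Type*} [Fintype ι] [Fintype κ]
    (x : EuclideanSpace ℝ ι) (hx : ‖x‖ = 1) :
    (gaussianMatrix ι κ).map (fun w => transposeMulCLM w x) =
      stdGaussian (EuclideanSpace ℝ κ) := by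
  rw [← map_stdGaussian_of_adjoint_isometry
    (fun g : EuclideanSpace ℝ (ι × κ) => transposeMulCLM (WithLp.ofLp g) x)
    ((continuous_transposeMulCLM_apply x).comp (PiLp.continuous_ofLp 2 _)).measurable
    (fun t => WithLp.toLp 2 fun p => x p.1 * t p.2), ← map_pi_eq_stdGaussian, gaussianMatrix,
    Measure.map_map]
  · rfl
  · exact ((continuous_transposeMulCLM_apply x).comp (PiLp.continuous_ofLp 2 _)).measurable
  · fun_prop
  · intro g t
    simp only [PiLp.inner_apply, transposeMulCLM_apply, RCLike.inner_apply, conj_trivial,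
      Finset.mul_sum]
    rw [Fintype.sum_prod_type_right]
    exact Finset.sum_congr rfl fun u _ => Finset.sum_congr rfl fun v _ => by ring
  · intro t
    have : ‖(WithLp.toLp 2 fun p : ι × κ => x p.1 * t p.2 : EuclideanSpace ℝ (ι × κ))‖ ^ 2 =
        (‖x‖ * ‖t‖) ^ 2 := by
      rw [mul_pow]
      simp only [EuclideanSpace.real_norm_sq_eq, Finset.sum_mul_sum, Fintype.sum_prod_type, mul_pow]
    rw [pow_left_inj₀ (by positivity) (by positivity) two_ne_zero, hx, one_mul] at this
    exact this

theorem map_gaussianMatrix_swap {ι κ : Type*} [Fintype ι] [Fintype κ] :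
    (gaussianMatrix ι κ).map (fun w (p : κ × ι) => w p.swap) = gaussianMatrix κ ι :=
  (measurePreserving_piCongrLeft (fun _ : κ × ι => gaussianReal 0 1) (Equiv.prodComm ι κ)).map_eq

/-- On a fixed subspace of small dimension, a Gaussian matrix is bounded below. -/
theorem gaussianMatrix_real_lt_on_submodule_le {ι κ : Type*} [Fintype ι] [Fintype κ]
    (V : Submodule ℝ (EuclideanSpace ℝ ι)) (hV : Module.finrank ℝ V * 100 ≤ Fintype.card κ) :
    (gaussianMatrix ι κ).real
      {w | ∃ x ∈ V, ‖transposeMulCLM w x‖ ^ 2 < Fintype.card κ / 18 * ‖x‖ ^ 2} ≤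
      2 * Real.exp (-(Fintype.card κ / 4 : ℝ)) := by
  set N : ℝ := (Fintype.card κ : ℝ) with hN
  obtain ⟨s, hs1, hnet, hcard⟩ := exists_sphere_net V (ε := 1 / 10) (by norm_num)
  let bad1 : V → Set (ι × κ → ℝ) := fun y =>
    {w | ‖transposeMulCLM w (y : EuclideanSpace ℝ ι)‖ ^ 2 ≤ N / 4}
  let bad2 : V → Set (ι × κ → ℝ) := fun y =>
    {w | 4 * N ≤ ‖transposeMulCLM w (y : EuclideanSpace ℝ ι)‖ ^ 2}
  have hfr : (Module.finrank ℝ (EuclideanSpace ℝ κ) : ℝ) = N := by simp [hN]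
  have hb1 : ∀ y ∈ s, (gaussianMatrix ι κ).real (bad1 y) ≤ Real.exp (-(3 / 10) * N) := by
    intro y hy
    have h := stdGaussian_real_norm_sq_le_le (EuclideanSpace ℝ κ)
    rw [← map_gaussianMatrix_transposeMulCLM (y : EuclideanSpace ℝ ι) (by simpa using hs1 y hy),
      map_measureReal_apply (continuous_transposeMulCLM_apply _).measurable
        (measurableSet_le (by fun_prop) (by fun_prop)), hfr] at h
    exact h
  have hb2 : ∀ y ∈ s, (gaussianMatrix ι κ).real (bad2 y) ≤ Real.exp (-(3 / 10) * N) := by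
    intro y hy
    have h := stdGaussian_real_le_norm_sq_le (EuclideanSpace ℝ κ)
    rw [← map_gaussianMatrix_transposeMulCLM (y : EuclideanSpace ℝ ι) (by simpa using hs1 y hy),
      map_measureReal_apply (continuous_transposeMulCLM_apply _).measurable
        (measurableSet_le (by fun_prop) (by fun_prop)), hfr] at h
    exact h
  have hsub : {w | ∃ x ∈ V, ‖transposeMulCLM w x‖ ^ 2 < N / 18 * ‖x‖ ^ 2} ⊆
      (⋃ y ∈ s, bad1 y) ∪ ⋃ y ∈ s, bad2 y := by
    rintro w ⟨x, hxV, hx⟩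
    by_contra hcon
    simp only [Set.mem_union, Set.mem_iUnion, not_or, not_exists, bad1, bad2, Set.mem_ofPred_eq,
      not_le] at hcon
    obtain ⟨h1, h2⟩ := hcon
    have hN0 : 0 ≤ N := by positivity
    -- The net yields `√N (1 / 2 - 2 / 9) ≥ √N / 4`, and `1 / 16 > 1 / 18`.
    have := le_norm_of_net (ε := 1 / 10) (a := √N / 2) (B := 2 * √N) (by norm_num) (by positivity)
      ((transposeMulCLM w).comp V.subtypeL) s hnet
      (fun y hy => by
        refine abs_le_of_sq_le_sq' ?_ (by positivity) |>.2
        rw [mul_pow, Real.sq_sqrt hN0]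
        have := h2 y hy
        simp only [ContinuousLinearMap.comp_apply, Submodule.subtypeL_apply]
        linarith)
      (fun y hy => by
        refine abs_le_of_sq_le_sq' ?_ (by positivity) |>.2
        rw [div_pow, Real.sq_sqrt hN0]
        have := h1 y hy
        simp only [ContinuousLinearMap.comp_apply, Submodule.subtypeL_apply]
        linarith) ⟨x, hxV⟩
    simp only [ContinuousLinearMap.comp_apply, Submodule.subtypeL_apply, Submodule.coe_norm] at this
    have h3 : √N * (1 / 4) * ‖x‖ ≤ ‖transposeMulCLM w x‖ := by
      refine le_trans ?_ this
      refine mul_le_mul_of_nonneg_right ?_ (norm_nonneg _)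
      have := Real.sqrt_nonneg N
      norm_num
      linarith
    have h4 := pow_le_pow_left₀ (by positivity) h3 2
    rw [mul_pow, mul_pow, Real.sq_sqrt hN0] at h4
    have : 0 ≤ N * ‖x‖ ^ 2 := by positivity
    nlinarith
  -- `21 ≤ e⁴` and the dimension is at most `N / 100`, so the net costs far less than the rate `3 N
  -- / 10`.
  have hcard' : (s.card : ℝ) ≤ Real.exp (N / 25) := by
    refine hcard.trans ?_
    have h21 : (1 + 2 / (1 / 10) : ℝ) ≤ Real.exp 4 := by
      have h := Real.exp_one_gt_d9
      have : Real.exp 4 = Real.exp 1 ^ 4 := by rw [← Real.exp_nat_mul]; norm_num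
      rw [this]
      calc (1 + 2 / (1 / 10) : ℝ) ≤ 2.7 ^ 4 := by norm_num
        _ ≤ _ := pow_le_pow_left₀ (by norm_num) (by linarith) 4
    refine (pow_le_pow_left₀ (by norm_num) h21 _).trans ?_
    rw [← Real.exp_nat_mul, Real.exp_le_exp]
    have : (Module.finrank ℝ V : ℝ) * 100 ≤ N := by rw [hN]; exact_mod_cast hV
    linarith
  have hun : ∀ bad : V → Set (ι × κ → ℝ),
      (∀ y ∈ s, (gaussianMatrix ι κ).real (bad y) ≤ Real.exp (-(3 / 10) * N)) →
      (gaussianMatrix ι κ).real (⋃ y ∈ s, bad y) ≤ Real.exp (-(N / 4)) := by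
    intro bad hbad
    calc _ ≤ ∑ y ∈ s, (gaussianMatrix ι κ).real (bad y) := measureReal_biUnion_finset_le _ _
      _ ≤ s.card * Real.exp (-(3 / 10) * N) := by
          rw [← nsmul_eq_mul]; exact Finset.sum_le_card_nsmul _ _ _ hbad
      _ ≤ Real.exp (N / 25) * Real.exp (-(3 / 10) * N) :=
          mul_le_mul_of_nonneg_right hcard' (Real.exp_pos _).le
      _ ≤ _ := by
          rw [← Real.exp_add, Real.exp_le_exp]
          have hN0 : 0 ≤ N := by positivity
          linarith
  calc _ ≤ _ := measureReal_mono hsub (measure_ne_top _ _)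
    _ ≤ _ := measureReal_union_le _ _
    _ ≤ _ := by linarith [hun bad1 hb1, hun bad2 hb2]

/-- A Gaussian matrix whose rows, in some orthonormal basis, are damped by small weights has small
operator norm. -/
theorem gaussianMatrix_real_weighted_gt_le {ι κ J : Type*} [Fintype ι] [Fintype κ] [Fintype J]
    (b : OrthonormalBasis J ℝ (EuclideanSpace ℝ ι)) {a : J → ℝ} {Λ : ℝ} (hΛ : 0 < Λ)
    (ha1 : ∀ j, Λ * a j ≤ 1) (ha0 : ∀ j, 0 ≤ a j) (hsum : ∑ j, a j ≤ 1 / 32) :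
    (gaussianMatrix ι κ).real
      {w | ∃ y : EuclideanSpace ℝ κ, 1 / 2 * ‖y‖ ^ 2 <
        ∑ j, a j * inner ℝ (b j) (transposeMulCLM (fun p : κ × ι => w p.swap) y) ^ 2} ≤
      Real.exp (2 * Fintype.card κ - Λ / 64) := by
  obtain ⟨s, hs1, hnet, hcard⟩ := exists_sphere_net (EuclideanSpace ℝ κ) (ε := 1 / 2) (by norm_num)
  -- A `1 / 2`-net loses a factor 2 in the norm, so `1 / 8` on the net becomes `1 / 2` on the
  -- sphere.
  let bad : EuclideanSpace ℝ κ → Set (ι × κ → ℝ) := fun y =>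
    {w | 1 / 8 ≤ ∑ j, a j * inner ℝ (b j) (transposeMulCLM (fun p : κ × ι => w p.swap) y) ^ 2}
  have hb : ∀ y ∈ s, (gaussianMatrix ι κ).real (bad y) ≤ Real.exp (-(Λ * (1 / 8) / 8)) := by
    intro y hy
    have h := stdGaussian_real_weighted_ge_le b hΛ ha1 ha0 (η := 1 / 8) (by linarith)
    rw [← map_gaussianMatrix_transposeMulCLM (ι := κ) y (hs1 y hy), ← map_gaussianMatrix_swap,
      map_measureReal_apply (continuous_transposeMulCLM_apply _).measurable
        (measurableSet_le (by fun_prop) (by fun_prop)),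
      map_measureReal_apply (by fun_prop)
        ((continuous_transposeMulCLM_apply _).measurable
          (measurableSet_le (by fun_prop) (by fun_prop)))] at h
    exact h
  have hsub : {w | ∃ y : EuclideanSpace ℝ κ, 1 / 2 * ‖y‖ ^ 2 <
        ∑ j, a j * inner ℝ (b j) (transposeMulCLM (fun p : κ × ι => w p.swap) y) ^ 2} ⊆
      ⋃ y ∈ s, bad y := by
    rintro w ⟨x, hx⟩
    by_contra hcon
    simp only [Set.mem_iUnion, not_exists, bad, Set.mem_ofPred_eq, not_le] at hcon
    let T : EuclideanSpace ℝ κ →L[ℝ] EuclideanSpace ℝ J := LinearMap.toContinuousLinearMap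
      { toFun := fun y => WithLp.toLp 2 fun j =>
          √(a j) * inner ℝ (b j) (transposeMulCLM (fun p : κ × ι => w p.swap) y)
        map_add' := fun y z => by ext j; simp [inner_add_right, mul_add]
        map_smul' := fun r y => by ext j; simp [inner_smul_right, mul_left_comm] }
    have hT : ∀ y, ‖T y‖ ^ 2 =
        ∑ j, a j * inner ℝ (b j) (transposeMulCLM (fun p : κ × ι => w p.swap) y) ^ 2 := by
      intro y
      rw [EuclideanSpace.real_norm_sq_eq]
      refine Finset.sum_congr rfl fun j _ => ?_
      change (√(a j) * inner ℝ (b j) (transposeMulCLM (fun p : κ × ι => w p.swap) y)) ^ 2 = _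
      rw [mul_pow, Real.sq_sqrt (ha0 j)]
    have h := norm_le_of_net (ε := 1 / 2) (B := √(1 / 8)) (by norm_num) (by positivity) T s hnet
      (fun y hy => Real.le_sqrt_of_sq_le (by rw [hT]; exact (hcon y hy).le)) x
    have h2 := pow_le_pow_left₀ (by positivity) h 2
    rw [mul_pow, div_pow, Real.sq_sqrt (by norm_num), hT] at h2
    norm_num at h2
    linarith
  have hcard' : (s.card : ℝ) ≤ Real.exp (2 * Fintype.card κ) := by
    refine hcard.trans ?_
    have h5 : (1 + 2 / (1 / 2) : ℝ) ≤ Real.exp 2 := by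
      have h := Real.exp_one_gt_d9
      have : Real.exp 2 = Real.exp 1 ^ 2 := by rw [← Real.exp_nat_mul]; norm_num
      rw [this]
      calc (1 + 2 / (1 / 2) : ℝ) ≤ 2.7 ^ 2 := by norm_num
        _ ≤ _ := pow_le_pow_left₀ (by norm_num) (by linarith) 2
    refine (pow_le_pow_left₀ (by norm_num) h5 _).trans ?_
    rw [← Real.exp_nat_mul, Real.exp_le_exp, finrank_euclideanSpace]
    linarith
  calc _ ≤ _ := measureReal_mono hsub (measure_ne_top _ _)
    _ ≤ ∑ y ∈ s, (gaussianMatrix ι κ).real (bad y) := measureReal_biUnion_finset_le _ _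
    _ ≤ s.card * Real.exp (-(Λ * (1 / 8) / 8)) := by
        rw [← nsmul_eq_mul]; exact Finset.sum_le_card_nsmul _ _ _ hb
    _ ≤ Real.exp (2 * Fintype.card κ) * Real.exp (-(Λ * (1 / 8) / 8)) :=
        mul_le_mul_of_nonneg_right hcard' (Real.exp_pos _).le
    _ ≤ _ := by
        rw [← Real.exp_add, Real.exp_le_exp]
        linarith

/-! ### Spread spectra and the effect of fresh Gaussian columns. -/

/-- Singular value decomposition, as a diagonalization of `x ↦ ‖T x‖²` with nondecreasing
coefficients. -/
theorem exists_orthonormalBasis_norm_sq_eq {E F : Type*} [NormedAddCommGroup E]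
    [InnerProductSpace ℝ E] [FiniteDimensional ℝ E] [NormedAddCommGroup F] [InnerProductSpace ℝ F]
    [FiniteDimensional ℝ F] {m : ℕ} (hm : Module.finrank ℝ E = m)
    (T : E →L[ℝ] F) :
    ∃ (b : OrthonormalBasis (Fin m) ℝ E) (l : Fin m → ℝ),
      Monotone l ∧ (∀ j, 0 ≤ l j) ∧ ∀ x, ‖T x‖ ^ 2 = ∑ j, l j * inner ℝ (b j) x ^ 2 := by
  have hpos := LinearMap.isPositive_adjoint_comp_self (T : E →ₗ[ℝ] F)
  have hsym := hpos.isSymmetric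
  -- Mathlib orders the eigenvalues decreasingly, hence the reversal.
  refine ⟨(hsym.eigenvectorBasis hm).reindex Fin.revPerm, fun j => hsym.eigenvalues hm j.rev,
    fun i j hij => hsym.eigenvalues_antitone hm (Fin.rev_le_rev.2 hij),
    fun j => hpos.nonneg_eigenvalues hm _, fun x => ?_⟩
  have h1 : ‖T x‖ ^ 2 = inner ℝ x ((LinearMap.adjoint (T : E →ₗ[ℝ] F) ∘ₗ (T : E →ₗ[ℝ] F)) x) := by
    rw [LinearMap.comp_apply, LinearMap.adjoint_inner_right, real_inner_self_eq_norm_sq]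
    rfl
  rw [h1, ← (hsym.eigenvectorBasis hm).sum_inner_mul_inner, ← Equiv.sum_comp Fin.revPerm]
  refine Finset.sum_congr rfl fun j _ => ?_
  simp only [Fin.revPerm_apply, OrthonormalBasis.reindex_apply, Fin.revPerm_symm]
  rw [← hsym, hsym.apply_eigenvectorBasis, inner_smul_left, real_inner_comm]
  simp
  ring

/-- The `j`-th smallest singular value of `T` (from `j = 0`) is at least `√(τ j)`, in min-max form:
every nonzero subspace `V` has a nonzero `x` with `τ (dim V - 1) ‖x‖² ≤ ‖T x‖²`. -/
def SpectrumSpread {E F : Type*} [NormedAddCommGroup E] [NormedSpace ℝ E]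
    [NormedAddCommGroup F] [NormedSpace ℝ F] (τ : ℝ) (T : E →L[ℝ] F) : Prop :=
  ∀ V : Submodule ℝ E, V ≠ ⊥ →
    ∃ x ∈ V, x ≠ 0 ∧ τ * ((Module.finrank ℝ V : ℝ) - 1) * ‖x‖ ^ 2 ≤ ‖T x‖ ^ 2

/-- Test the spread on the span of the first `j + 1` basis vectors, where `‖T x‖² ≤ l j * ‖x‖²`. -/
theorem SpectrumSpread.le_coeff {E F : Type*} [NormedAddCommGroup E]
    [InnerProductSpace ℝ E] [FiniteDimensional ℝ E] [NormedAddCommGroup F] [InnerProductSpace ℝ F]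
    {τ : ℝ} {T : E →L[ℝ] F} (hT : SpectrumSpread τ T) {m : ℕ}
    (b : OrthonormalBasis (Fin m) ℝ E) {l : Fin m → ℝ} (hl : Monotone l)
    (h : ∀ x, ‖T x‖ ^ 2 = ∑ j, l j * inner ℝ (b j) x ^ 2) (j : Fin m) : τ * (j : ℕ) ≤ l j := by
  let V : Submodule ℝ E := Submodule.span ℝ (Set.range fun i : Fin (j + 1) => b (Fin.castLE j.2 i))
  have hlin : LinearIndependent ℝ fun i : Fin (j + 1) => b (Fin.castLE j.2 i) :=
    b.orthonormal.linearIndependent.comp _ (Fin.castLE_injective j.2)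
  have hrank : Module.finrank ℝ V = j + 1 := by
    rw [finrank_span_eq_card hlin, Fintype.card_fin]
  have hV : V ≠ ⊥ := by
    intro h0
    rw [h0, finrank_bot] at hrank
    omega
  obtain ⟨x, hxV, hx0, hx⟩ := hT V hV
  have horth : ∀ i, j < i → inner ℝ (b i) x = 0 := by
    intro i hi
    have hle : V ≤ LinearMap.ker (innerₛₗ ℝ (b i)) := by
      refine Submodule.span_le.2 ?_
      rintro _ ⟨r, rfl⟩
      have : i ≠ Fin.castLE j.2 r := by
        intro hir
        have h1 := congrArg Fin.val hir
        have h2 := r.2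
        have h3 : (j : ℕ) < i := hi
        simp only [Fin.val_castLE] at h1
        omega
      simp [b.inner_eq_ite, this]
    simpa using hle hxV
  have hle : ‖T x‖ ^ 2 ≤ l j * ‖x‖ ^ 2 := by
    rw [h, ← b.sum_sq_inner_right x, Finset.mul_sum]
    refine Finset.sum_le_sum fun i _ => ?_
    rcases le_or_gt i j with hij | hij
    · exact mul_le_mul_of_nonneg_right (hl hij) (sq_nonneg _)
    · simp [horth i hij]
  rw [hrank] at hx
  push_cast at hx
  rw [add_sub_cancel_right] at hx
  exact le_of_mul_le_mul_right (hx.trans hle) (by positivity)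

/-- Linear growth of the squared singular values makes their reciprocals sum harmonically; besides
the union bound, this is the source of `log n`. -/
theorem sum_inv_Ico_le {d m n : ℕ} (hmn : m ≤ n) :
    ∑ j : Fin m, (if (j : ℕ) < d + 1 then (0 : ℝ) else ((j : ℕ) : ℝ)⁻¹) ≤ 1 + Real.log n := by
  have h := harmonic_le_one_add_log n
  refine le_trans ?_ h
  rw [harmonic]
  push_cast
  rw [Fin.sum_univ_eq_sum_range (fun j => if j < d + 1 then (0 : ℝ) else (j : ℝ)⁻¹) m]
  calc _ ≤ ∑ j ∈ Finset.range (n + 1), (j : ℝ)⁻¹ := by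
        refine (Finset.sum_le_sum fun j _ => ?_).trans
          (Finset.sum_le_sum_of_subset_of_nonneg (Finset.range_mono (by omega))
            fun _ _ _ => by positivity)
        split_ifs <;> simp
    _ = _ := by rw [Finset.sum_range_succ']; simp

/-- Deterministic step: if the low part of `x` is not shrunk by `G` and the high part of `x` is
mapped by `G` to a vector that is small in comparison with `q`, then `‖G x‖²` and `q` cannot be
both small. -/
theorem add_norm_sq_ge {E F : Type*} [NormedAddCommGroup E] [NormedAddCommGroup F]
    [NormedSpace ℝ E] [NormedSpace ℝ F] (G : E →L[ℝ] F) {e f : E} {q t : ℝ}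
    (he : t * ‖e‖ ^ 2 ≤ ‖G e‖ ^ 2) (hf : ‖G f‖ ^ 2 ≤ q / 2) :
    q / 2 + t / 2 * ‖e‖ ^ 2 ≤ q + ‖G (e + f)‖ ^ 2 := by
  have h1 : ‖G e‖ ≤ ‖G (e + f)‖ + ‖G f‖ := by
    have := norm_sub_le (G (e + f)) (G f)
    rwa [← map_sub, add_sub_cancel_right] at this
  have h2 := pow_le_pow_left₀ (norm_nonneg _) h1 2
  nlinarith [sq_nonneg (‖G (e + f)‖ - ‖G f‖)]

/-- Orthogonal splitting along the first `d` vectors of an orthonormal basis. -/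
theorem exists_split_orthonormalBasis {E : Type*} [NormedAddCommGroup E]
    [InnerProductSpace ℝ E] {m : ℕ} (b : OrthonormalBasis (Fin m) ℝ E) (d : ℕ) (x : E) :
    ∃ e ∈ Submodule.span ℝ (b '' {j | (j : ℕ) < d}), ∃ f : E, e + f = x ∧
      (∀ j, inner ℝ (b j) f = if (j : ℕ) < d then 0 else inner ℝ (b j) x) ∧
      ‖x‖ ^ 2 = ‖e‖ ^ 2 + ‖f‖ ^ 2 := by
  let c : Fin m → ℝ := fun j => if (j : ℕ) < d then inner ℝ (b j) x else 0
  let c' : Fin m → ℝ := fun j => if (j : ℕ) < d then 0 else inner ℝ (b j) x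
  have hin : ∀ (c : Fin m → ℝ) j, inner ℝ (b j) (∑ i, c i • b i) = c j := fun c j => by
    simp [inner_sum, inner_smul_right, b.inner_eq_ite]
  refine ⟨∑ j, c j • b j, ?_, ∑ j, c' j • b j, ?_, hin c', ?_⟩
  · refine Submodule.sum_mem _ fun j _ => ?_
    by_cases hj : (j : ℕ) < d
    · exact Submodule.smul_mem _ _ (Submodule.subset_span ⟨j, hj, rfl⟩)
    · simp [c, hj]
  · rw [← Finset.sum_add_distrib]
    conv_rhs => rw [← b.sum_repr' x]
    refine Finset.sum_congr rfl fun j _ => ?_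
    by_cases hj : (j : ℕ) < d <;> simp [c, c', hj]
  · simp_rw [← b.sum_sq_inner_right, hin]
    rw [← Finset.sum_add_distrib]
    refine Finset.sum_congr rfl fun j _ => ?_
    by_cases hj : (j : ℕ) < d <;> simp [c, c', hj]

/-- Duality: for `y = wᵀ f` one has `‖y‖² = ⟨f, w y⟩`, and Cauchy–Schwarz with weights `√(l j)` and
`1 / √(l j)` gives `‖y‖⁴ ≤ q * ‖y‖² / 2`, where `q` is the sum in the conclusion. -/
theorem norm_sq_transposeMulCLM_high_le {ι κ : Type*} [Fintype ι] [Fintype κ] {m : ℕ}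
    (b : OrthonormalBasis (Fin m) ℝ (EuclideanSpace ℝ ι)) {d : ℕ} {l : Fin m → ℝ}
    (hl : ∀ j : Fin m, d ≤ (j : ℕ) → 0 < l j) (w : ι × κ → ℝ)
    (hw : ∀ y : EuclideanSpace ℝ κ, ∑ j : Fin m, (if (j : ℕ) < d then 0 else (l j)⁻¹) *
      inner ℝ (b j) (transposeMulCLM (fun p : κ × ι => w p.swap) y) ^ 2 ≤ 1 / 2 * ‖y‖ ^ 2)
    (x f : EuclideanSpace ℝ ι)
    (hf : ∀ j, inner ℝ (b j) f = if (j : ℕ) < d then 0 else inner ℝ (b j) x) :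
    ‖transposeMulCLM w f‖ ^ 2 ≤
      (∑ j : Fin m, if (j : ℕ) < d then 0 else l j * inner ℝ (b j) x ^ 2) / 2 := by
  set y := transposeMulCLM w f with hy
  set q := ∑ j : Fin m, if (j : ℕ) < d then 0 else l j * inner ℝ (b j) x ^ 2 with hq
  set z := transposeMulCLM (fun p : κ × ι => w p.swap) y with hz
  have hq0 : 0 ≤ q := Finset.sum_nonneg fun j _ => by
    split_ifs with h
    · exact le_rfl
    · exact mul_nonneg (hl j (not_lt.1 h)).le (sq_nonneg _)
  have h1 : ‖y‖ ^ 2 = ∑ j : Fin m, (if (j : ℕ) < d then 0 else √(l j) * inner ℝ (b j) x) *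
      (if (j : ℕ) < d then 0 else (√(l j))⁻¹ * inner ℝ (b j) z) := by
    rw [← real_inner_self_eq_norm_sq, hy, inner_transposeMulCLM, ← hy, ← hz,
      ← b.sum_inner_mul_inner]
    refine Finset.sum_congr rfl fun j _ => ?_
    rw [real_inner_comm, hf]
    split_ifs with h
    · simp
    · have := (Real.sqrt_pos.2 (hl j (not_lt.1 h))).ne'
      field_simp
  have h2 := Finset.sum_mul_sq_le_sq_mul_sq Finset.univ
    (fun j : Fin m => if (j : ℕ) < d then 0 else √(l j) * inner ℝ (b j) x)
    (fun j : Fin m => if (j : ℕ) < d then 0 else (√(l j))⁻¹ * inner ℝ (b j) z)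
  rw [← h1] at h2
  have h3 : ∑ j : Fin m, (if (j : ℕ) < d then 0 else √(l j) * inner ℝ (b j) x) ^ 2 = q := by
    refine Finset.sum_congr rfl fun j _ => ?_
    split_ifs with h
    · simp
    · rw [mul_pow, Real.sq_sqrt (hl j (not_lt.1 h)).le]
  have h4 : ∑ j : Fin m, (if (j : ℕ) < d then 0 else (√(l j))⁻¹ * inner ℝ (b j) z) ^ 2 ≤
      1 / 2 * ‖y‖ ^ 2 := by
    refine le_of_eq_of_le (Finset.sum_congr rfl fun j _ => ?_) (hw y)
    split_ifs with h
    · simp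
    · rw [mul_pow, inv_pow, Real.sq_sqrt (hl j (not_lt.1 h)).le]
  rw [h3] at h2
  have h5 := h2.trans (mul_le_mul_of_nonneg_left h4 hq0)
  by_contra! hcon
  have : 0 < ‖y‖ ^ 2 := by linarith
  nlinarith

theorem finrank_span_image_lt_le {E : Type*} [AddCommGroup E] [Module ℝ E] {m : ℕ}
    (b : Fin m → E) (d : ℕ) :
    Module.finrank ℝ (Submodule.span ℝ (b '' {j | (j : ℕ) < d})) ≤ d := by
  classical
  rw [Set.image_eq_range]
  refine (finrank_range_le_card fun j : {j : Fin m | (j : ℕ) < d} => b j).trans ?_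
  have := Fintype.card_le_of_injective
    (fun j : {j : Fin m | (j : ℕ) < d} => (⟨(j : Fin m), j.2⟩ : Fin d))
    (fun i j h => Subtype.ext (Fin.ext (by simpa using h)))
  simpa using this

/-- The main step: adding `C k` Gaussian columns to a fixed matrix with spread spectrum makes all
singular values at least `√(C k) / 6`. -/
theorem gaussianMatrix_real_lt_of_spectrumSpread {ι κ F : Type*} [Fintype ι] [Fintype κ]
    [NormedAddCommGroup F] [InnerProductSpace ℝ F] [FiniteDimensional ℝ F] {n C k : ℕ}
    (hι : Fintype.card ι ≤ n) (hκ : Fintype.card κ = C * k) (hk : 1 ≤ k)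
    (hC : (1400000 : ℝ) ≤ C) (hlog : 1152 * (1 + Real.log n) ≤ C)
    {A : EuclideanSpace ℝ ι →L[ℝ] F} (hA : SpectrumSpread (C / 36 : ℝ) A) :
    (gaussianMatrix ι κ).real {w | ∃ x : EuclideanSpace ℝ ι,
      ‖A x‖ ^ 2 + ‖transposeMulCLM w x‖ ^ 2 < C / 36 * k * ‖x‖ ^ 2} ≤
      Real.exp (-(C * k / 8 : ℝ)) := by
  obtain ⟨m, hm⟩ : ∃ m, Module.finrank ℝ (EuclideanSpace ℝ ι) = m := ⟨_, rfl⟩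
  obtain ⟨b, l, hmono, hl0, hAl⟩ := exists_orthonormalBasis_norm_sq_eq hm A
  have hlj := hA.le_coeff b hmono hAl
  have hmn : m ≤ n := by rw [← hm, finrank_euclideanSpace]; exact hι
  have hk' : (1 : ℝ) ≤ k := by exact_mod_cast hk
  have hCk : (C : ℝ) ≤ C * k := by nlinarith
  -- The cutoff `d = ⌊C k / 100⌋` is small enough for the net bound on the first `d` directions, yet
  -- leaves `l j ≥ C d / 36` on the others. It is a successor, which excludes `j = 0` from the
  -- harmonic sum.
  obtain ⟨d', hd'⟩ : ∃ d', C * k / 100 = d' + 1 := by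
    refine Nat.exists_eq_succ_of_ne_zero ?_
    have : (1400000 : ℝ) ≤ (C * k : ℕ) := by push_cast; linarith
    have : 1400000 ≤ C * k := by exact_mod_cast this
    omega
  set d := d' + 1 with hd
  have hd1 : (C : ℝ) * k / 200 ≤ d := by
    have h1 : C * k < 100 * (d + 1) := by omega
    have h2 : (C : ℝ) * k < 100 * (d + 1) := by exact_mod_cast h1
    linarith
  have hd2 : d * 100 ≤ C * k := by omega
  set Λ : ℝ := C / 36 * d with hΛ
  have hd0 : (0 : ℝ) < d := by rw [hd]; positivity
  have hC0 : (0 : ℝ) < C := by linarith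
  have hΛ0 : 0 < Λ := by positivity
  have hΛl : ∀ j : Fin m, d ≤ (j : ℕ) → Λ ≤ l j := fun j hj =>
    le_trans (mul_le_mul_of_nonneg_left (Nat.cast_le.2 hj) (by positivity)) (hlj j)
  let a : Fin m → ℝ := fun j => if (j : ℕ) < d then 0 else (l j)⁻¹
  have ha0 : ∀ j, 0 ≤ a j := fun j => by
    simp only [a]; split_ifs
    · exact le_rfl
    · exact inv_nonneg.2 (hl0 j)
  have ha1 : ∀ j, Λ * a j ≤ 1 := fun j => by
    simp only [a]; split_ifs with h
    · simp
    · have := hΛl j (not_lt.1 h)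
      rw [← div_eq_mul_inv, div_le_one (by linarith)]
      exact this
  -- `1152 = 36 * 32`.
  have hasum : ∑ j, a j ≤ 1 / 32 := by
    calc ∑ j, a j ≤ ∑ j : Fin m, 36 / (C : ℝ) *
          (if (j : ℕ) < d' + 1 then (0 : ℝ) else ((j : ℕ) : ℝ)⁻¹) := by
          refine Finset.sum_le_sum fun j _ => ?_
          simp only [a]
          split_ifs with h
          · simp
          · have hj : (0 : ℝ) < (j : ℕ) := by
              have : 0 < (j : ℕ) := by omega
              exact_mod_cast this
            calc (l j)⁻¹ ≤ (C / 36 * (j : ℕ) : ℝ)⁻¹ := inv_anti₀ (by positivity) (hlj j)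
              _ = _ := by field_simp
      _ ≤ 36 / (C : ℝ) * (1 + Real.log n) := by
          rw [← Finset.mul_sum]
          exact mul_le_mul_of_nonneg_left (sum_inv_Ico_le hmn) (by positivity)
      _ ≤ 1 / 32 := by
          rw [div_mul_eq_mul_div, div_le_div_iff₀ hC0 (by norm_num)]
          linarith
  let V := Submodule.span ℝ (b '' {j | (j : ℕ) < d})
  have hV : Module.finrank ℝ V * 100 ≤ Fintype.card κ := by
    rw [hκ]
    refine le_trans (Nat.mul_le_mul_right _ ?_) hd2
    exact finrank_span_image_lt_le b d
  have hlow := gaussianMatrix_real_lt_on_submodule_le (κ := κ) V hV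
  have hhigh := gaussianMatrix_real_weighted_gt_le (κ := κ) b hΛ0 ha1 ha0 hasum
  rw [hκ] at hlow hhigh
  push_cast at hlow hhigh
  set N : ℝ := (C : ℝ) * k with hN
  refine (measureReal_mono (s₂ := _ ∪ _) ?_ (measure_ne_top _ _)).trans
    ((measureReal_union_le _ _).trans ((add_le_add hlow hhigh).trans ?_))
  · rintro w ⟨x, hx⟩
    by_contra hcon
    simp only [Set.mem_union, Set.mem_ofPred_eq, not_or, not_exists, not_and, not_lt] at hcon
    obtain ⟨h1, h2⟩ := hcon
    obtain ⟨e, heV, f, hef, hfj, hnorm⟩ := exists_split_orthonormalBasis b d x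
    have hGf := norm_sq_transposeMulCLM_high_le b (fun j hj => hΛ0.trans_le (hΛl j hj)) w h2 x f hfj
    set q := ∑ j : Fin m, if (j : ℕ) < d then 0 else l j * inner ℝ (b j) x ^ 2 with hq
    have hqA : q ≤ ‖A x‖ ^ 2 := by
      rw [hAl]
      refine Finset.sum_le_sum fun j _ => ?_
      split_ifs
      · exact mul_nonneg (hl0 j) (sq_nonneg _)
      · exact le_rfl
    have hqf : Λ * ‖f‖ ^ 2 ≤ q := by
      rw [← b.sum_sq_inner_right f, Finset.mul_sum]
      refine Finset.sum_le_sum fun j _ => ?_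
      rw [hfj]
      split_ifs with h
      · simp
      · exact mul_le_mul_of_nonneg_right (hΛl j (not_lt.1 h)) (sq_nonneg _)
    have h3 := add_norm_sq_ge (transposeMulCLM w) (h1 e heV) hGf
    rw [hef] at h3
    have h4 : N / 36 * ‖f‖ ^ 2 ≤ Λ / 2 * ‖f‖ ^ 2 := by
      refine mul_le_mul_of_nonneg_right ?_ (sq_nonneg _)
      rw [hΛ, hN]
      have : (2 : ℝ) * k ≤ d := by
        refine le_trans ?_ hd1
        rw [hN]; nlinarith
      nlinarith
    rw [hnorm] at hx
    have h5 : (C : ℝ) / 36 * k = N / 36 := by rw [hN]; ring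
    rw [h5] at hx
    nlinarith
  · have hN1 : 1400000 ≤ N := hC.trans hCk
    -- `Λ / 64 ≥ C N / 460800` must beat `9 N / 4`: the most demanding lower bound on `C` here,
    -- satisfied from `1036800` on.
    have h1 : Real.exp (2 * N - Λ / 64) ≤ Real.exp (-(N / 4)) := by
      rw [Real.exp_le_exp]
      have h2 : (C : ℝ) / 36 * (N / 200) ≤ Λ := mul_le_mul_of_nonneg_left hd1 (by positivity)
      nlinarith
    have h3 : (3 : ℝ) ≤ Real.exp (N / 8) := by
      linarith [Real.add_one_le_exp (N / 8)]
    calc _ ≤ 3 * Real.exp (-(N / 4)) := by linarith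
      _ ≤ Real.exp (N / 8) * Real.exp (-(N / 4)) :=
          mul_le_mul_of_nonneg_right h3 (Real.exp_pos _).le
      _ = _ := by rw [← Real.exp_add]; congr 1; ring

/-! ### Measurability and conditioning. -/

theorem continuous_transposeMulCLM {ι κ : Type*} [Fintype ι] [Fintype κ] :
    Continuous fun p : (ι × κ → ℝ) × EuclideanSpace ℝ ι => transposeMulCLM p.1 p.2 := by
  refine (PiLp.continuous_toLp 2 _).comp (continuous_pi fun v => ?_)
  fun_prop

/-- Needed for measurability: the condition is an intersection over uncountably many subspaces, so
closedness is proved. By homogeneity, for each subspace failure is a strict inequality on its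
compact unit sphere, an open condition. -/
theorem isClosed_spectrumSpread {ι κ : Type*} [Fintype ι] [Fintype κ] (τ : ℝ) :
    IsClosed {w : ι × κ → ℝ | SpectrumSpread τ (transposeMulCLM w)} := by
  simp only [SpectrumSpread, Set.ofPred_forall]
  refine isClosed_iInter fun V => isClosed_iInter fun hV => ?_
  rw [← isOpen_compl_iff]
  set t := τ * ((Module.finrank ℝ V : ℝ) - 1)
  let K : Set (EuclideanSpace ℝ ι) := (V : Set (EuclideanSpace ℝ ι)) ∩ Metric.sphere 0 1
  have hK : IsCompact K := (isCompact_sphere _ _).inter_left V.closed_of_finiteDimensional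
  have heq : {w : ι × κ → ℝ | ∃ x ∈ V, x ≠ 0 ∧ t * ‖x‖ ^ 2 ≤ ‖transposeMulCLM w x‖ ^ 2}ᶜ =
      {w | ∀ x ∈ K, ‖transposeMulCLM w x‖ ^ 2 < t} := by
    ext w
    simp only [Set.mem_compl_iff, Set.mem_ofPred_eq, not_exists, not_and, not_le]
    constructor
    · rintro h x ⟨hxV, hx⟩
      rw [mem_sphere_zero_iff_norm] at hx
      have := h x hxV (by rintro rfl; simp at hx)
      simpa [hx] using this
    · intro h x hxV hx0
      have hx : 0 < ‖x‖ := norm_pos_iff.2 hx0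
      have := h ((‖x‖⁻¹ : ℝ) • x) ⟨V.smul_mem _ hxV, by
        rw [mem_sphere_zero_iff_norm, norm_smul, norm_inv, norm_norm]; field_simp⟩
      rw [map_smul, norm_smul, norm_inv, norm_norm, inv_mul_eq_div, div_pow,
        div_lt_iff₀ (by positivity)] at this
      exact this
  rw [heq, isOpen_iff_eventually]
  intro w hw
  refine hK.eventually_forall_of_forall_eventually fun x hx => ?_
  have hc : Continuous fun p : (ι × κ → ℝ) × EuclideanSpace ℝ ι =>
      ‖transposeMulCLM p.1 p.2‖ ^ 2 := continuous_transposeMulCLM.norm.pow 2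
  exact hc.continuousAt.eventually_lt continuousAt_const (hw x hx)

theorem isOpen_exists_norm_sq_lt {ι κ γ : Type*} [Fintype ι] [Fintype κ] [Fintype γ] (t : ℝ) :
    IsOpen {p : (ι × κ → ℝ) × (ι × γ → ℝ) | ∃ x : EuclideanSpace ℝ ι,
      ‖transposeMulCLM p.2 x‖ ^ 2 + ‖transposeMulCLM p.1 x‖ ^ 2 < t * ‖x‖ ^ 2} := by
  rw [Set.ofPred_exists]
  refine isOpen_iUnion fun x => isOpen_lt ?_ continuous_const
  exact (((continuous_transposeMulCLM_apply x).comp continuous_snd).norm.pow 2).add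
    (((continuous_transposeMulCLM_apply x).comp continuous_fst).norm.pow 2)

/-- If `X` and `Y` are independent, the probability of an event about `(X, Y)` that is small for
every fixed value of `Y` is small. -/
theorem measureReal_le_of_indepFun {Ω α β : Type*} [MeasurableSpace Ω] [MeasurableSpace α]
    [MeasurableSpace β] {P : Measure Ω} [IsProbabilityMeasure P] {X : Ω → α} {Y : Ω → β}
    (hX : Measurable X) (hY : Measurable Y) (h : IndepFun X Y P) {s : Set (α × β)}
    (hs : MeasurableSet s) {δ : ℝ} (hδ : 0 ≤ δ)
    (hb : ∀ y, (P.map X).real {x | (x, y) ∈ s} ≤ δ) :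
    P.real {ω | (X ω, Y ω) ∈ s} ≤ δ := by
  have := Measure.isProbabilityMeasure_map (μ := P) hX.aemeasurable
  have := Measure.isProbabilityMeasure_map (μ := P) hY.aemeasurable
  have h1 := (indepFun_iff_map_prod_eq_prod_map_map hX.aemeasurable hY.aemeasurable).1 h
  have h2 : P {ω | (X ω, Y ω) ∈ s} ≤ ENNReal.ofReal δ := by
    calc P {ω | (X ω, Y ω) ∈ s} = P.map (fun ω => (X ω, Y ω)) s :=
          (Measure.map_apply (hX.prodMk hY) hs).symm
      _ = ∫⁻ y, P.map X ((fun x => (x, y)) ⁻¹' s) ∂(P.map Y) := by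
          rw [h1, Measure.prod_apply_symm hs]
      _ ≤ ∫⁻ _, ENNReal.ofReal δ ∂(P.map Y) := by
          refine lintegral_mono fun y => ?_
          rw [← ofReal_measureReal]
          exact ENNReal.ofReal_le_ofReal (hb y)
      _ = ENNReal.ofReal δ := by simp
  exact ENNReal.toReal_le_of_le_ofReal hδ h2

/-! ### Blocks of the staircase and the deterministic induction. -/

section Staircase

variable {n C : ℕ}

/-- The rows up to `i`. -/
abbrev RowsUpTo (i : Fin n) : Type := {u : Fin n // u ≤ i}

/-- The columns before the block `j`. -/
abbrev ColsBefore (n C j : ℕ) : Type := {v : Fin (C * n) // (v : ℕ) < C * j}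

/-- The columns in the blocks `i, …, i + k - 1`. -/
abbrev ColsBetween (n C i k : ℕ) : Type :=
  {v : Fin (C * n) // C * i ≤ (v : ℕ) ∧ (v : ℕ) < C * (i + k)}

/-- The entries of a matrix in the rows up to `i` and the columns before the block `i`. -/
def oldBlock (M : Matrix (Fin n) (Fin (C * n)) ℝ) (i : Fin n) :
    RowsUpTo i × ColsBefore n C i → ℝ := fun p => M p.1 p.2

/-- The entries of a matrix in the rows up to `i` and the `k` column blocks from `i` on. -/
def freshBlock (M : Matrix (Fin n) (Fin (C * n)) ℝ) (i : Fin n) (k : ℕ) :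
    RowsUpTo i × ColsBetween n C i k → ℝ := fun p => M p.1 p.2

theorem card_rowsUpTo (i : Fin n) : Fintype.card (RowsUpTo i) = i + 1 := by
  rw [Fintype.card_subtype]
  have : (Finset.univ.filter fun u : Fin n => u ≤ i) = Finset.Iic i := by ext; simp
  rw [this, Fin.card_Iic]

theorem card_colsBetween {i k : ℕ} (hik : i + k ≤ n) :
    Fintype.card (ColsBetween n C i k) = C * k := by
  have hle : C * (i + k) ≤ C * n := Nat.mul_le_mul_left C hik
  have e : ColsBetween n C i k ≃ Finset.Ico (C * i) (C * (i + k)) :=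
    { toFun := fun v => ⟨v.1, Finset.mem_Ico.2 v.2⟩
      invFun := fun v => ⟨⟨v.1, (Finset.mem_Ico.1 v.2).2.trans_le hle⟩, Finset.mem_Ico.1 v.2⟩
      left_inv := fun v => rfl
      right_inv := fun v => rfl }
  rw [Fintype.card_congr e, Fintype.card_coe, Nat.card_Ico, Nat.mul_add]
  omega

theorem sum_subtype_ite {α : Type*} [Fintype α] (p : α → Prop) [DecidablePred p] (h : α → ℝ) :
    ∑ v : {v // p v}, h v = ∑ v, if p v then h v else 0 := by
  rw [← Finset.sum_filter, Finset.sum_subtype (p := p) _ (by simp)]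

theorem sum_colsBefore_add (h : Fin (C * n) → ℝ) (i k : ℕ) :
    ∑ v : ColsBefore n C i, h v + ∑ v : ColsBetween n C i k, h v =
      ∑ v : ColsBefore n C (i + k), h v := by
  rw [sum_subtype_ite (fun v : Fin (C * n) => (v : ℕ) < C * i),
    sum_subtype_ite (fun v : Fin (C * n) => C * i ≤ (v : ℕ) ∧ (v : ℕ) < C * (i + k)),
    sum_subtype_ite (fun v : Fin (C * n) => (v : ℕ) < C * (i + k)), ← Finset.sum_add_distrib]
  refine Finset.sum_congr rfl fun v _ => ?_
  have : C * i ≤ C * (i + k) := Nat.mul_le_mul_left C (by omega)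
  split_ifs <;> first | omega | simp

theorem norm_sq_oldBlock_add_freshBlock (M : Matrix (Fin n) (Fin (C * n)) ℝ) (i : Fin n) (k : ℕ)
    (x : EuclideanSpace ℝ (RowsUpTo i)) :
    ‖transposeMulCLM (oldBlock M i) x‖ ^ 2 + ‖transposeMulCLM (freshBlock M i k) x‖ ^ 2 =
      ∑ v : ColsBefore n C (i + k), (∑ u : RowsUpTo i, M u v * x u) ^ 2 := by
  rw [norm_sq_transposeMulCLM, norm_sq_transposeMulCLM]
  exact sum_colsBefore_add (fun v => (∑ u : RowsUpTo i, M u v * x u) ^ 2) i k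

/-- Sums over the rows up to `i` of a function that vanishes after row `i'`. -/
theorem sum_rowsUpTo_eq {i i' : Fin n} (h : i' ≤ i) (f : RowsUpTo i → ℝ)
    (hf : ∀ u : RowsUpTo i, i' < u.1 → f u = 0) :
    ∑ u : RowsUpTo i', f ⟨u, u.2.trans h⟩ = ∑ u : RowsUpTo i, f u := by
  refine Fintype.sum_of_injective (fun u : RowsUpTo i' => (⟨u, u.2.trans h⟩ : RowsUpTo i))
    (fun u v huv => ?_) _ _ (fun u hu => hf u ?_) (fun _ => rfl)
  · simpa [Subtype.ext_iff] using huv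
  · by_contra hcon
    exact hu ⟨⟨u.1, not_lt.1 hcon⟩, rfl⟩

/-- A subspace of dimension above `i - i'` has a nonzero vector supported on the rows up to `i'`. -/
theorem exists_mem_supported {i i' : Fin n}
    (V : Submodule ℝ (EuclideanSpace ℝ (RowsUpTo i)))
    (hV : (i : ℕ) - i' < Module.finrank ℝ V) :
    ∃ x ∈ V, x ≠ 0 ∧ ∀ u : RowsUpTo i, i' < u.1 → x u = 0 := by
  let f : V →ₗ[ℝ] ({u : RowsUpTo i // i' < u.1} → ℝ) :=
    { toFun := fun x u => (x : EuclideanSpace ℝ (RowsUpTo i)) u.1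
      map_add' := fun x y => by ext; simp
      map_smul' := fun r x => by ext; simp }
  have hcard : Fintype.card {u : RowsUpTo i // i' < u.1} ≤ (i : ℕ) - i' := by
    have e : Function.Injective fun u : {u : RowsUpTo i // i' < u.1} =>
        (⟨u.1.1, Finset.mem_Ioc.2 ⟨u.2, u.1.2⟩⟩ : Finset.Ioc i' i) := by
      intro u v huv
      simpa [Subtype.ext_iff] using huv
    have := Fintype.card_le_of_injective _ e
    rwa [Fintype.card_coe, Fin.card_Ioc] at this
  have hker := LinearMap.ker_ne_bot_of_finrank_lt (f := f)
    (by rw [Module.finrank_fintype_fun_eq_card]; omega)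
  obtain ⟨x, hx, hx0⟩ := (Submodule.ne_bot_iff _).1 hker
  exact ⟨x, x.2, by simpa using hx0, fun u hu => congrFun (LinearMap.mem_ker.1 hx) ⟨u, hu⟩⟩

/-- The deterministic induction along the staircase: the spectra of all the old blocks are spread,
if in each step the fresh columns do their work. -/
theorem spectrumSpread_oldBlock {τ : ℝ} (M : Matrix (Fin n) (Fin (C * n)) ℝ)
    (hstep : ∀ (i : Fin n) (k : ℕ), 1 ≤ k → (i : ℕ) + k ≤ n →
      SpectrumSpread τ (transposeMulCLM (oldBlock M i)) →
      ∀ x : EuclideanSpace ℝ (RowsUpTo i), τ * k * ‖x‖ ^ 2 ≤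
        ‖transposeMulCLM (oldBlock M i) x‖ ^ 2 + ‖transposeMulCLM (freshBlock M i k) x‖ ^ 2)
    (i : Fin n) : SpectrumSpread τ (transposeMulCLM (oldBlock M i)) := by
  induction i using WellFoundedLT.induction with
  | ind i ih =>
  intro V hV
  obtain ⟨r, hr⟩ : ∃ r, Module.finrank ℝ V = r + 1 := by
    refine Nat.exists_eq_succ_of_ne_zero fun h0 => hV ?_
    exact Submodule.finrank_eq_zero.1 h0
  have hri : r ≤ i := by
    have := Submodule.finrank_le V
    rw [hr, finrank_euclideanSpace, card_rowsUpTo] at this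
    omega
  rcases Nat.eq_zero_or_pos r with h0 | hpos
  · obtain ⟨x, hx, hx0⟩ := (Submodule.ne_bot_iff _).1 hV
    refine ⟨x, hx, hx0, ?_⟩
    rw [hr, h0]
    simp
  -- Vanishing on the last `r` rows is `r` linear conditions, fewer than the dimension `r + 1`. The
  -- columns before block `i` are those before block `i'` and `r` blocks that are fresh for `i'`.
  · let i' : Fin n := ⟨i - r, by omega⟩
    have hi' : i' < i := by
      rw [Fin.lt_def]; simp only [i']; omega
    have hi'r : (i' : ℕ) + r = i := by simp only [i']; omega
    obtain ⟨x, hxV, hx0, hsupp⟩ := exists_mem_supported (i' := i') V (by omega)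
    refine ⟨x, hxV, hx0, ?_⟩
    let x' : EuclideanSpace ℝ (RowsUpTo i') := WithLp.toLp 2 fun u => x ⟨u, u.2.trans hi'.le⟩
    have hnorm : ‖x'‖ ^ 2 = ‖x‖ ^ 2 := by
      rw [EuclideanSpace.real_norm_sq_eq, EuclideanSpace.real_norm_sq_eq]
      exact sum_rowsUpTo_eq hi'.le (fun u => x u ^ 2) fun u hu => by simp [hsupp u hu]
    have hs := hstep i' r hpos (by have := i.2; omega) (ih i' hi') x'
    rw [norm_sq_oldBlock_add_freshBlock, hnorm, hi'r] at hs
    rw [hr, norm_sq_transposeMulCLM]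
    push_cast
    rw [add_sub_cancel_right]
    refine hs.trans_eq (Finset.sum_congr rfl fun v _ => ?_)
    congr 1
    exact sum_rowsUpTo_eq hi'.le (fun u => M u v * x u) fun u hu => by simp [hsupp u hu]

end Staircase

/-- Evaluate the hypothesis at an eigenvector of `Tᵀ T` for the square of the smallest singular
value. -/
theorem le_minSingularValue {n m : ℕ} (hn : 1 ≤ n) (M : Matrix (Fin n) (Fin m) ℝ) {s : ℝ}
    (h : ∀ y : EuclideanSpace ℝ (Fin n),
      s ^ 2 * ‖y‖ ^ 2 ≤ ∑ v, (∑ u, M u v * y u) ^ 2) : s ≤ minSingularValue M := by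
  set T := Matrix.toEuclideanLin M.transpose with hT
  have hev := T.hasEigenvalue_adjoint_comp_self_sq_singularValues (n := n - 1)
    (by rw [finrank_euclideanSpace, Fintype.card_fin]; omega)
  obtain ⟨y, hy⟩ := hev.exists_hasEigenvector
  have h1 : ‖T y‖ ^ 2 = T.singularValues (n - 1) ^ 2 * ‖y‖ ^ 2 := by
    have : inner ℝ (((LinearMap.adjoint T) ∘ₗ T) y) y = ‖T y‖ ^ 2 := by
      rw [LinearMap.comp_apply, LinearMap.adjoint_inner_left, real_inner_self_eq_norm_sq]
    rw [← this, hy.apply_eq_smul, inner_smul_left, real_inner_self_eq_norm_sq]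
    simp
  have h2 : ‖T y‖ ^ 2 = ∑ v, (∑ u, M u v * y u) ^ 2 := by
    rw [EuclideanSpace.real_norm_sq_eq]
    simp [hT, Matrix.toLpLin_apply, Matrix.mulVec, dotProduct]
  have h3 := h y
  rw [← h2, h1] at h3
  have hy0 : 0 < ‖y‖ := norm_pos_iff.2 hy.2
  have h4 := le_of_mul_le_mul_right h3 (by positivity)
  exact abs_le_of_sq_le_sq' h4 (T.singularValues_nonneg _) |>.2

/-! ### Probability of failure. -/

section Probability

variable {Ω : Type*} [MeasurableSpace Ω] {P : Measure Ω} {n C : ℕ}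
  {M : Ω → Matrix (Fin n) (Fin (C * n)) ℝ}

theorem measurable_oldBlock (hmeas : ∀ i j, Measurable fun ω => M ω i j) (i : Fin n) :
    Measurable fun ω => oldBlock (M ω) i :=
  measurable_pi_lambda _ fun _ => hmeas _ _

theorem measurable_freshBlock (hmeas : ∀ i j, Measurable fun ω => M ω i j) (i : Fin n) (k : ℕ) :
    Measurable fun ω => freshBlock (M ω) i k :=
  measurable_pi_lambda _ fun _ => hmeas _ _

theorem inStaircase_fresh {i : Fin n} {k : ℕ} (p : RowsUpTo i × ColsBetween n C i k) :
    InStaircase p.1.1 p.2.1 := by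
  have h1 : (p.1.1 : ℕ) ≤ i := p.1.2
  exact (Nat.mul_le_mul_right C h1).trans ((Nat.mul_comm _ _).trans_le p.2.2.1)

theorem indepFun_freshBlock_oldBlock (hadapt : StaircaseAdaptive P M) (i : Fin n) (k : ℕ) :
    IndepFun (fun ω => freshBlock (M ω) i k) (fun ω => oldBlock (M ω) i) P := by
  have h1 : Measurable fun (w : {p : Fin n × Fin (C * n) //
      InStaircase p.1 p.2 ∧ C * (i : ℕ) ≤ (p.2 : ℕ)} → ℝ)
      (p : RowsUpTo i × ColsBetween n C i k) => w ⟨(p.1.1, p.2.1), inStaircase_fresh p, p.2.2.1⟩ :=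
    measurable_pi_lambda _ fun _ => measurable_pi_apply _
  have h2 : Measurable fun (w : {p : Fin n × Fin (C * n) //
      p.1 ≤ i ∧ (p.2 : ℕ) < C * (i : ℕ)} → ℝ)
      (p : RowsUpTo i × ColsBefore n C i) => w ⟨(p.1.1, p.2.1), p.1.2, p.2.2⟩ :=
    measurable_pi_lambda _ fun _ => measurable_pi_apply _
  exact (hadapt i).comp h1 h2

variable [IsProbabilityMeasure P]

theorem map_freshBlock (hmeas : ∀ i j, Measurable fun ω => M ω i j)
    (hiid : StaircaseIIDGaussian P M) (i : Fin n) (k : ℕ) :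
    P.map (fun ω => freshBlock (M ω) i k) = gaussianMatrix (RowsUpTo i) (ColsBetween n C i k) := by
  have hind := hiid.2.precomp
    (g := fun p : RowsUpTo i × ColsBetween n C i k => ⟨(p.1.1, p.2.1), inStaircase_fresh p⟩)
    (fun p q h => by
      simp only [Subtype.mk.injEq, Prod.mk.injEq] at h
      exact Prod.ext (Subtype.ext h.1) (Subtype.ext h.2))
  have h := (iIndepFun_iff_map_fun_eq_pi_map (fun _ => (hmeas _ _).aemeasurable)).1 hind
  refine h.trans ?_
  unfold gaussianMatrix
  congr 1
  funext p
  exact (hiid.1 _ _ (inStaircase_fresh p)).map_eq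

/-- Freeze the old block: by independence the fresh block remains Gaussian. Frozen values without
spread spectrum contribute nothing. -/
theorem measureReal_step_failure_le (hmeas : ∀ i j, Measurable fun ω => M ω i j)
    (hiid : StaircaseIIDGaussian P M) (hadapt : StaircaseAdaptive P M)
    (hC : (1400000 : ℝ) ≤ C) (hlog : 1152 * (1 + Real.log n) ≤ C)
    (i : Fin n) {k : ℕ} (hk : 1 ≤ k) (hik : (i : ℕ) + k ≤ n) :
    P.real {ω | SpectrumSpread (C / 36 : ℝ) (transposeMulCLM (oldBlock (M ω) i)) ∧
      ∃ x : EuclideanSpace ℝ (RowsUpTo i), ‖transposeMulCLM (oldBlock (M ω) i) x‖ ^ 2 +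
        ‖transposeMulCLM (freshBlock (M ω) i k) x‖ ^ 2 < C / 36 * k * ‖x‖ ^ 2} ≤
      Real.exp (-(C / 8 : ℝ)) := by
  refine measureReal_le_of_indepFun
    (s := {p | SpectrumSpread (C / 36 : ℝ) (transposeMulCLM p.2) ∧
      ∃ x : EuclideanSpace ℝ (RowsUpTo i), ‖transposeMulCLM p.2 x‖ ^ 2 +
        ‖transposeMulCLM p.1 x‖ ^ 2 < C / 36 * k * ‖x‖ ^ 2})
    (measurable_freshBlock hmeas i k) (measurable_oldBlock hmeas i)
    (indepFun_freshBlock_oldBlock hadapt i k) ?_ (Real.exp_pos _).le fun w => ?_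
  · exact (((isClosed_spectrumSpread _).preimage continuous_snd).measurableSet).inter
      (isOpen_exists_norm_sq_lt _).measurableSet
  · rw [map_freshBlock hmeas hiid]
    by_cases hw : SpectrumSpread (C / 36 : ℝ) (transposeMulCLM w)
    · simp only [Set.mem_ofPred_eq, hw, true_and]
      refine (gaussianMatrix_real_lt_of_spectrumSpread (n := n) ?_ (card_colsBetween hik) hk hC
        hlog hw).trans (Real.exp_le_exp.2 ?_)
      · rw [card_rowsUpTo]; exact i.2
      · have : (1 : ℝ) ≤ k := by exact_mod_cast hk
        nlinarith
    · simp only [Set.mem_ofPred_eq, hw, false_and]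
      simpa using (Real.exp_pos _).le

/-- Sums over all rows and columns, as sums over the old and the fresh block of the last row. -/
theorem sum_sq_eq_norm_sq_last {i : Fin n} (hi : (i : ℕ) + 1 = n)
    (A : Matrix (Fin n) (Fin (C * n)) ℝ) (y : EuclideanSpace ℝ (Fin n)) :
    ∃ x : EuclideanSpace ℝ (RowsUpTo i), ‖x‖ ^ 2 = ‖y‖ ^ 2 ∧
      ‖transposeMulCLM (oldBlock A i) x‖ ^ 2 + ‖transposeMulCLM (freshBlock A i 1) x‖ ^ 2 =
        ∑ v, (∑ u, A u v * y u) ^ 2 := by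
  have hle : ∀ u : Fin n, u ≤ i := fun u => by rw [Fin.le_def]; omega
  have hsum : ∀ f : Fin n → ℝ, ∑ u : RowsUpTo i, f u = ∑ u, f u := fun f =>
    Fintype.sum_equiv (Equiv.subtypeUnivEquiv hle) _ _ fun _ => rfl
  refine ⟨WithLp.toLp 2 fun u => y u, ?_, ?_⟩
  · rw [EuclideanSpace.real_norm_sq_eq, EuclideanSpace.real_norm_sq_eq]
    exact hsum fun u => y u ^ 2
  · rw [norm_sq_oldBlock_add_freshBlock]
    have hlt : ∀ v : Fin (C * n), (v : ℕ) < C * (i + 1) := fun v => by rw [hi]; exact v.2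
    refine Fintype.sum_equiv (Equiv.subtypeUnivEquiv hlt) _ _ fun v => ?_
    exact congrArg (· ^ 2) (hsum fun u => A u v * y u)

/-- With a logarithmic number of columns per block, the smallest singular value of an adaptive
Gaussian staircase matrix is at least `√C / 6` with high probability. -/
theorem measureReal_minSingularValue_lt_le (hn : 1 ≤ n)
    (hmeas : ∀ i j, Measurable fun ω => M ω i j)
    (hiid : StaircaseIIDGaussian P M) (hadapt : StaircaseAdaptive P M)
    (hC : (1400000 : ℝ) ≤ C) (hlog : 1152 * (1 + Real.log n) ≤ C) :
    P.real {ω | minSingularValue (M ω) < √C / 6} ≤ Real.exp (-(C : ℝ) / 16) := by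
  -- The second index stands for `k - 1`; pairs with `i + k > n` give the empty event.
  let bad : Fin n × Fin n → Set Ω := fun p =>
    if (p.1 : ℕ) + ((p.2 : ℕ) + 1) ≤ n then
      {ω | SpectrumSpread (C / 36 : ℝ) (transposeMulCLM (oldBlock (M ω) p.1)) ∧
        ∃ x : EuclideanSpace ℝ (RowsUpTo p.1), ‖transposeMulCLM (oldBlock (M ω) p.1) x‖ ^ 2 +
          ‖transposeMulCLM (freshBlock (M ω) p.1 (p.2 + 1)) x‖ ^ 2 <
            C / 36 * ((p.2 + 1 : ℕ) : ℝ) * ‖x‖ ^ 2}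
    else ∅
  have hbad : ∀ p, P.real (bad p) ≤ Real.exp (-(C / 8 : ℝ)) := by
    intro p
    simp only [bad]
    split_ifs with h
    · exact measureReal_step_failure_le hmeas hiid hadapt hC hlog p.1 (by omega) h
    · simpa using (Real.exp_pos _).le
  have hsub : {ω | minSingularValue (M ω) < √C / 6} ⊆ ⋃ p ∈ Finset.univ, bad p := by
    intro ω hω
    by_contra hcon
    simp only [Finset.mem_univ, Set.iUnion_true, Set.mem_iUnion, not_exists] at hcon
    have hstep : ∀ (i : Fin n) (k : ℕ), 1 ≤ k → (i : ℕ) + k ≤ n →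
        SpectrumSpread (C / 36 : ℝ) (transposeMulCLM (oldBlock (M ω) i)) →
        ∀ x : EuclideanSpace ℝ (RowsUpTo i), (C / 36 : ℝ) * k * ‖x‖ ^ 2 ≤
          ‖transposeMulCLM (oldBlock (M ω) i) x‖ ^ 2 +
            ‖transposeMulCLM (freshBlock (M ω) i k) x‖ ^ 2 := by
      intro i k hk hik hS x
      obtain ⟨k, rfl⟩ : ∃ k', k = k' + 1 := ⟨k - 1, by omega⟩
      have h := hcon (i, ⟨k, by omega⟩)
      simp only [bad, if_pos hik, Set.mem_ofPred_eq, not_and, not_exists, not_lt] at h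
      exact h hS x
    have hS := spectrumSpread_oldBlock (M ω) hstep
    let i : Fin n := ⟨n - 1, by omega⟩
    have hi : (i : ℕ) + 1 = n := Nat.sub_add_cancel hn
    refine (not_le.2 hω) (le_minSingularValue hn _ fun y => ?_)
    obtain ⟨x, hxy, hsum⟩ := sum_sq_eq_norm_sq_last hi (M ω) y
    -- For the last row, the old block and one fresh block form the whole matrix, and `C / 36 = (√C
    -- / 6)²`.
    have := hstep i 1 le_rfl hi.le (hS i) x
    rw [hsum, hxy] at this
    refine le_of_eq_of_le ?_ this
    rw [div_pow, Real.sq_sqrt (by positivity)]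
    norm_num
  have hn0 : (0 : ℝ) < n := by exact_mod_cast hn
  calc _ ≤ _ := measureReal_mono hsub (measure_ne_top _ _)
    _ ≤ ∑ p, P.real (bad p) := measureReal_biUnion_finset_le _ _
    _ ≤ (Fintype.card (Fin n × Fin n) : ℝ) * Real.exp (-(C / 8 : ℝ)) := by
        rw [← nsmul_eq_mul]; exact Finset.sum_le_card_nsmul _ _ _ fun p _ => hbad p
    -- The `n²` events cost `2 log n ≤ C / 16`.
    _ = Real.exp (2 * Real.log n) * Real.exp (-(C / 8 : ℝ)) := by
        rw [two_mul, Real.exp_add, Real.exp_log hn0]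
        simp
    _ ≤ _ := by
        rw [← Real.exp_add, Real.exp_le_exp]
        linarith

/-- For a single row the smallest singular value is the norm of a Gaussian vector. -/
theorem measureReal_minSingularValue_lt_le_of_one (hn : n = 1)
    (hmeas : ∀ i j, Measurable fun ω => M ω i j) (hiid : StaircaseIIDGaussian P M) :
    P.real {ω | minSingularValue (M ω) < √C / 6} ≤ Real.exp (-(C : ℝ) / 16) := by
  subst hn
  let e : EuclideanSpace ℝ (RowsUpTo (0 : Fin 1)) := WithLp.toLp 2 fun _ => 1
  have he : ‖e‖ = 1 := by
    rw [← pow_left_inj₀ (norm_nonneg _) zero_le_one two_ne_zero, EuclideanSpace.real_norm_sq_eq]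
    simp [e, card_rowsUpTo]
  have hcard : Fintype.card (ColsBetween 1 C ((0 : Fin 1) : ℕ) 1) = C :=
    (card_colsBetween le_rfl).trans (mul_one C)
  have h := stdGaussian_real_norm_sq_le_le (EuclideanSpace ℝ (ColsBetween 1 C ((0 : Fin 1) : ℕ) 1))
  rw [← map_gaussianMatrix_transposeMulCLM e he, ← map_freshBlock hmeas hiid (0 : Fin 1) 1,
    Measure.map_map (continuous_transposeMulCLM_apply e).measurable
      (measurable_freshBlock hmeas _ _),
    map_measureReal_apply ((continuous_transposeMulCLM_apply e).measurable.comp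
      (measurable_freshBlock hmeas _ _)) (measurableSet_le (by fun_prop) (by fun_prop)),
    finrank_euclideanSpace, hcard] at h
  refine (measureReal_mono ?_ (measure_ne_top _ _)).trans (h.trans (Real.exp_le_exp.2 ?_))
  · intro ω hω
    by_contra hcon
    simp only [Set.mem_preimage, Set.mem_ofPred_eq, not_le, Function.comp_apply] at hcon
    refine (not_le.2 hω) (le_minSingularValue le_rfl _ fun y => ?_)
    obtain ⟨x, hxy, hsum⟩ := sum_sq_eq_norm_sq_last (i := (0 : Fin 1)) rfl (M ω) y
    have hx : x = x ⟨0, le_rfl⟩ • e := by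
      ext u
      have : u = ⟨0, le_rfl⟩ := Subsingleton.elim _ _
      simp [this, e]
    have hnx : ‖x‖ ^ 2 = x ⟨0, le_rfl⟩ ^ 2 := by
      conv_lhs => rw [hx]
      rw [norm_smul, he, mul_one, Real.norm_eq_abs, sq_abs]
    have hfx : ‖transposeMulCLM (freshBlock (M ω) 0 1) x‖ ^ 2 =
        x ⟨0, le_rfl⟩ ^ 2 * ‖transposeMulCLM (freshBlock (M ω) 0 1) e‖ ^ 2 := by
      conv_lhs => rw [hx]
      rw [map_smul, norm_smul, mul_pow, Real.norm_eq_abs, sq_abs]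
    rw [← hsum, ← hxy, hnx, hfx, div_pow, Real.sq_sqrt (by positivity)]
    have hC0 : (0 : ℝ) ≤ C := by positivity
    have h1 : (C : ℝ) / 6 ^ 2 ≤ ‖transposeMulCLM (freshBlock (M ω) 0 1) e‖ ^ 2 := by
      refine le_trans ?_ hcon.le
      linarith
    nlinarith [mul_le_mul_of_nonneg_left h1 (sq_nonneg (x ⟨0, le_rfl⟩)),
      sq_nonneg ‖transposeMulCLM (oldBlock (M ω) 0) x‖]
  · have hC0 : (0 : ℝ) ≤ C := by positivity
    linarith

end Probability

/-! ### The constant and the conclusion. -/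

/-- The base is at least `10 ^ 14` and the exponent at least `log 2 > 1 / 2`. -/
theorem le_staircaseConst {α : ℝ} (hα : 0 < α) (hα1 : α ≤ 1) :
    (10 : ℝ) ^ 7 ≤ staircaseConst (10 ^ 14) α := by
  have h1 : (10 : ℝ) ^ 14 ≤ 10 ^ 14 / α := by
    rw [le_div_iff₀ hα]
    nlinarith
  have hlog := Real.log_two_gt_d9
  have h2 : (1 / 2 : ℝ) ≤ Real.log 2 / α := by
    rw [le_div_iff₀ hα]
    linarith
  calc (10 : ℝ) ^ 7 = ((10 : ℝ) ^ 14) ^ (1 / 2 : ℝ) := by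
        rw [← Real.sqrt_eq_rpow, show (10 : ℝ) ^ 14 = (10 ^ 7) ^ 2 by norm_num,
          Real.sqrt_sq (by norm_num)]
    _ ≤ (10 ^ 14 / α) ^ (1 / 2 : ℝ) := Real.rpow_le_rpow (by norm_num) h1 (by norm_num)
    _ ≤ _ := Real.rpow_le_rpow_of_exponent_le (h1.trans' (by norm_num)) h2

theorem mainTheorem3 :
    ∃ C₂ : ℝ, 8 ≤ C₂ ∧
      ∀ (n C : ℕ), 1 ≤ n → 2 ≤ C →
      ∀ {Ω : Type*} [MeasurableSpace Ω] (P : Measure Ω) [IsProbabilityMeasure P]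
        (M : Ω → Matrix (Fin n) (Fin (C * n)) ℝ),
        (∀ i j, Measurable fun ω => M ω i j) →
        StaircaseIIDGaussian P M →
        StaircaseAdaptive P M →
        ∀ α : ℝ, 0 < α → α ≤ 1 →
          staircaseConst C₂ α * Real.log (n : ℝ) ≤ (C : ℝ) →
          P.real {ω | minSingularValue (M ω) < 1 / 6 * √((C : ℝ) / (n : ℝ) ^ α)} ≤
            3 * Real.exp (-(C : ℝ) / 16) := by
  refine ⟨10 ^ 14, by norm_num, ?_⟩
  intro n C hn _ Ω _ P _ M hmeas hiid hadapt α hα hα1 hCα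
  have hn1 : (1 : ℝ) ≤ n := by exact_mod_cast hn
  have hsqrt : 1 / 6 * √((C : ℝ) / (n : ℝ) ^ α) ≤ √C / 6 := by
    have : √((C : ℝ) / (n : ℝ) ^ α) ≤ √C :=
      Real.sqrt_le_sqrt (div_le_self (by positivity) (Real.one_le_rpow hn1 hα.le))
    linarith
  have hmain : P.real {ω | minSingularValue (M ω) < √C / 6} ≤ Real.exp (-(C : ℝ) / 16) := by
    -- For `n = 1` the logarithm vanishes and `C` may be small; for `n ≥ 2`, `C ≥ 10 ^ 7 * log 2`
    -- exceeds `1400000`.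
    rcases hn.eq_or_lt with h1 | h2
    · exact measureReal_minSingularValue_lt_le_of_one h1.symm hmeas hiid
    · have hlog2 : Real.log 2 ≤ Real.log n := Real.log_le_log two_pos (by exact_mod_cast h2)
      have hlog := Real.log_two_gt_d9
      have h3 : (10 : ℝ) ^ 7 * Real.log n ≤ C :=
        (mul_le_mul_of_nonneg_right (le_staircaseConst hα hα1) (by linarith)).trans hCα
      exact measureReal_minSingularValue_lt_le hn hmeas hiid hadapt (by linarith) (by linarith)
  have hexp := Real.exp_pos (-(C : ℝ) / 16)
  refine (measureReal_mono (fun ω hω => ?_) (measure_ne_top _ _)).trans (hmain.trans (by linarith))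
  exact lt_of_lt_of_le hω hsqrt
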